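/- Let $d\ge 2$ and $L\ge 1$ be integers and let $\Lambda=(\mathbb{Z}/L\mathbb{Z})^d$ be the $d$-dimensional hypercubic lattice of side length $L$ with periodic boundary conditions, with a spin $1/2$ on every site and $X_{\vec r},Y_{\vec r},Z_{\vec r}$ the Pauli operators on site $\vec r$. For real numbers $J^1,\dots,J^d,h^x,h^z$ let $$H=\sum_{\vec r\in\Lambda}\Bigl(\sum_{\mu=1}^{d}J^{\mu}Z_{\vec r}Z_{\vec r+\vec e_\mu}+h^xX_{\vec r}+h^zZ_{\vec r}\Bigr),$$ where $\vec e_\mu$ is the unit translation in direction $\mu$. A Pauli product is an operator $\prod_{\vec p\in\Lambda}A_{\vec p}$ with $A_{\vec p}\in\{I_{\vec p},X_{\vec p},Y_{\vec p},Z_{\vec p}\}$; its side lengths $\ell_1,\dots,\ell_d$ are those of the smallest (periodic) rectangular cuboid $\prod_{\mu}\{r_\mu,\dots,r_\mu+\ell_\mu-1\}$ that contains its support $\{\vec p: A_{\vec p}\ne I_{\vec p}\}$ (all are $0$ for the identity). A $(k_1,\dots,k_d)$-local conserved quantity of a Hamiltonian is an operator $Q$ commuting with it such that, for every $\mu=1,\dots,d$,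 the maximum of the side lengths $\ell_\mu$ of the Pauli products that have a nonzero coefficient in the expansion of $Q$ in Pauli products exists and equals $k_\mu$. Assume $J^1,J^2,h^x\neq 0$, while $J^3,\dots,J^d$ and $h^z$ are arbitrary real numbers. Let $k_1,\dots,k_d$ be integers with $3\le k_1\le L/2$ and $k_2,\dots,k_d$ arbitrary. Then $H$ has no $(k_1,k_2,\dots,k_d)$-local conserved quantity. In particular, the stack of $L^{d-2}$ decoupled two-dimensional layers $$\sum_{\vec s\in(\mathbb{Z}/L\mathbb{Z})^{d-2}}\ \sum_{\substack{\vec r\in\Lambda\\ (r_3,\dots,r_d)=\vec s}}\bigl(J^{1}Z_{\vec r}Z_{\vec r+\vec e_1}+J^{2}Z_{\vec r}Z_{\vec r+\vec e_2}+h^xX_{\vec r}+h^zZ_{\vec r}\bigr)$$ has no $(k_1,k_2,\dots,k_d)$-local conserved quantity either. -/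

import Mathlib

namespace QuantumIsing

/-- The `d`-dimensional hypercubic lattice of side length `L` with periodic boundary conditions. -/
abbrev Site (d L : ℕ) : Type := Fin d → ZMod L

/-- Operators on the spin-1/2 Hilbert space `⨂_r ℂ²` of the lattice, as matrices in the
computational basis (a basis vector assigns an element of `Fin 2` to every site). -/
abbrev Op (d L : ℕ) : Type := Matrix (Site d L → Fin 2) (Site d L → Fin 2) ℂ

/-- Labels of the four single-site Pauli operators. -/
inductive Pauli : Type
  | I
  | X
  | Y
  | Z
  deriving DecidableEq

instance : Fintype Pauli where
  elems := {.I, .X, .Y, .Z}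
  complete := by intro σ; cases σ <;> simp

/-- The `2 × 2` matrix of a single-site Pauli operator. -/
def Pauli.toMatrix : Pauli → Matrix (Fin 2) (Fin 2) ℂ
  | .I => 1
  | .X => !![0, 1; 1, 0]
  | .Y => !![0, -Complex.I; Complex.I, 0]
  | .Z => !![1, 0; 0, -1]

variable {d L : ℕ}

/-- The Pauli product `∏_p A_p`, i.e. the tensor product over all sites of the matrices `A_p`. -/
noncomputable def pauliProduct [NeZero L] (A : Site d L → Pauli) : Op d L :=
  Matrix.of fun s t => ∏ p, (A p).toMatrix (s p) (t p)

/-- The single-site operator `σ_r`: the Pauli operator `σ` on site `r`, the identity elsewhere. -/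
noncomputable def siteOp [NeZero L] (σ : Pauli) (r : Site d L) : Op d L :=
  pauliProduct (Function.update (fun _ => Pauli.I) r σ)

/-- The primitive translation vector in direction `μ`. -/
def unitVec (μ : Fin d) : Site d L := Pi.single μ 1

/-- The Hamiltonian
`H = ∑_r (∑_μ J^μ Z_r Z_{r+e_μ} + h^x X_r + h^z Z_r)`. -/
noncomputable def hamiltonian [NeZero L] (J : Fin d → ℝ) (hx hz : ℝ) : Op d L :=
  ∑ r : Site d L,
    ((∑ μ : Fin d, (J μ : ℂ) • (siteOp .Z r * siteOp .Z (r + unitVec μ)))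
      + (hx : ℂ) • siteOp .X r + (hz : ℂ) • siteOp .Z r)

/-- The Hamiltonian of a single two-dimensional layer: the couplings are in the first two directions
only, and the layer consists of the sites whose coordinates in all the other directions are `s`. -/
noncomputable def layerHamiltonian [NeZero L] (J : Fin d → ℝ) (hx hz : ℝ)
    (s : {μ : Fin d // 2 ≤ (μ : ℕ)} → ZMod L) : Op d L :=
  ∑ r : Site d L with ∀ μ : {μ : Fin d // 2 ≤ (μ : ℕ)}, r μ.1 = s μ,
    ((∑ μ : Fin d with μ.val < 2, (J μ : ℂ) • (siteOp .Z r * siteOp .Z (r + unitVec μ)))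
      + (hx : ℂ) • siteOp .X r + (hz : ℂ) • siteOp .Z r)

/-- The Hamiltonian of a stack of `L ^ (d - 2)` decoupled two-dimensional layers. -/
noncomputable def stackHamiltonian [NeZero L] (J : Fin d → ℝ) (hx hz : ℝ) : Op d L :=
  ∑ s : {μ : Fin d // 2 ≤ (μ : ℕ)} → ZMod L, layerHamiltonian J hx hz s

/-- The rectangular cuboid `∏_μ {r_μ, …, r_μ + ℓ_μ - 1}` (on the periodic lattice). -/
def cuboid (r : Site d L) (ℓ : Fin d → ℕ) : Set (Site d L) :=
  {p | ∀ μ, ∃ n : ℕ, n < ℓ μ ∧ p μ = r μ + (n : ZMod L)}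

/-- The side length in direction `μ` of the smallest rectangular cuboid containing `S`.
(It is `0` for `S = ∅`.) -/
noncomputable def sideLength (S : Set (Site d L)) (μ : Fin d) : ℕ :=
  sInf {n | ∃ (r : Site d L) (ℓ : Fin d → ℕ), S ⊆ cuboid r ℓ ∧ ℓ μ = n}

/-- The numbers `sideLength S μ` are the side lengths of one cuboid containing `S`, and no cuboid
containing `S` has a smaller side length in any direction. -/
theorem isLeast_sideLength [NeZero L] (S : Set (Site d L)) :
    IsLeast {ℓ : Fin d → ℕ | ∃ r, S ⊆ cuboid r ℓ} (sideLength S) := by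
  have hne : ∀ μ, {n | ∃ (r : Site d L) (ℓ : Fin d → ℕ), S ⊆ cuboid r ℓ ∧ ℓ μ = n}.Nonempty := by
    intro μ
    refine ⟨L, 0, fun _ => L, ?_, rfl⟩
    intro p _ ν
    exact ⟨(p ν).val, ZMod.val_lt _, by simp⟩
  constructor
  · choose r ℓ h h' using fun μ => Nat.sInf_mem (hne μ)
    refine ⟨fun μ => r μ μ, ?_⟩
    intro p hp μ
    obtain ⟨n, hn, e⟩ := h μ hp μ
    exact ⟨n, by rw [h' μ] at hn; exact hn, e⟩
  · rintro ℓ ⟨r, hr⟩ μ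
    exact Nat.sInf_le ⟨r, ℓ, hr, rfl⟩

/-- The support of a Pauli product. -/
def support (A : Site d L → Pauli) : Set (Site d L) := {p | A p ≠ .I}

/-- `Q` is a linear combination of Pauli products such that, for every direction `μ`, the maximum of
the side lengths `ℓ_μ` of the Pauli products that appear with a nonzero coefficient is `k_μ`.
(The identity may appear; its side lengths count as `0`.) -/
def IsLocal [NeZero L] (k : Fin d → ℕ) (Q : Op d L) : Prop :=
  ∃ c : (Site d L → Pauli) → ℂ,
    Q = ∑ A, c A • pauliProduct A ∧
    ∀ μ, IsGreatest {n | ∃ A, c A ≠ 0 ∧ sideLength (support A) μ = n} (k μ)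

/-- `Q` is a `(k_1, …, k_d)`-local conserved quantity of the Hamiltonian `H`. -/
def IsLocalConserved [NeZero L] (H : Op d L) (k : Fin d → ℕ) (Q : Op d L) : Prop :=
  Commute Q H ∧ IsLocal k Q

end QuantumIsing

open scoped symmDiff

namespace QuantumIsing

/-! Write `Q` in the basis `∏ X ∏ Z`. Since these operators are independent, `[Q, H] = 0` becomes
one linear equation per string (`coeff_eqn_of_commute`), with the `Z`-interactions on one side and
the field on the other. Only one direction `e` is sliced into planes. All other couplings and `h^z`
act inside a plane, so only a bond along `e` can change the width, and the claim is that every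
string of maximal width `k` has coefficient zero (`c_eq_zero_of_width`).

The equation at a target string chosen near the end planes of a string of width `k` has at most two
surviving terms. It forces the shape of the end planes and lets the string be translated by `e`.
Iterating pushes this rigidity through all planes: a string with an `X` on its last plane is `Z X …
X Y` on a line (`line_of_mem_last`). Once those are excluded, the others are `Z X … X Z`
(`line_of_width`). Both coefficients are constant along `e`.

The second dimension kills these two families. Decorate the line at its `j`-th site by a bond in the
transverse direction `f`. The resulting equations relate the decorated coefficient at `j` to the one
at `j - 1` of the translated line, and each step adds the same multiple of the line's coefficient.
At the last `j` a term is missing, so the recursion closes to `2(k-1) K α = 0` for `Z X … X Y`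
(`c_last_line_eq_zero`) and to `(2k-3) K β = 0` for `Z X … X Z` (`c_line_eq_zero`). Mirror symmetry
(`reflect`) transfers statements between the two ends.

The stack of layers is the same Hamiltonian with the remaining couplings set to zero. -/

/-- The linear system satisfied by the coefficients `c a b` of `∏_{p ∈ a} X_p ∏_{p ∈ b} Z_p` in an
operator commuting with `∑_T G T ∏_{p ∈ T} Z_p + h ∑_p X_p`. The homomorphism `x` slices the sites
into planes, the only interactions between planes are the bonds `{p, p + e}`, and the operator has
width at most `k` in the direction of `e`. -/
structure CoeffSystem (V : Type*) [AddCommGroup V] [Fintype V] [DecidableEq V] (L k : ℕ) where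
  x : V →+ ZMod L
  e : V
  f : V
  G : Finset V → ℂ
  J : ℂ
  K : ℂ
  h : ℂ
  c : Finset V → Finset V → ℂ
  three_le : 3 ≤ k
  two_mul_le : 2 * k ≤ L
  x_e : x e = 1
  x_f : x f = 0
  f_ne : f ≠ 0
  J_ne : J ≠ 0
  K_ne : K ≠ 0
  h_ne : h ≠ 0
  G_e : ∀ p, G {p, p + e} = J
  G_f : ∀ p, G {p, p + f} = K
  G_local : ∀ T, G T ≠ 0 → (∀ p ∈ T, ∀ q ∈ T, x p = x q) ∨ ∃ p, T = {p, p + e}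
  slab : ∀ a b, c a b ≠ 0 → ∃ m : ℤ, ∀ y ∈ a ∪ b, ∃ n : ℤ, m ≤ n ∧ n < m + k ∧ x y = n
  eqn : ∀ a b, ∑ T with Odd (T ∩ a).card, G T * c a (b ∆ T) = h * ∑ s ∈ b, c (a ∆ {s}) b

/-! ### Planes, width, and the interactions that can clear an end plane. -/

namespace CoeffSystem

theorem odd_card_pair_inter {V : Type*} [DecidableEq V] {a : Finset V} {p q : V} (hpq : p ≠ q) :
    Odd (({p, q} : Finset V) ∩ a).card ↔ ¬ (p ∈ a ↔ q ∈ a) := by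
  by_cases hp : p ∈ a <;> by_cases hq : q ∈ a <;>
    simp [Finset.insert_inter_of_mem, Finset.insert_inter_of_notMem, hp, hq, hpq]

variable {V : Type*} [AddCommGroup V] [Fintype V] [DecidableEq V] {L k : ℕ}
  (S : CoeffSystem V L k)

/-- The same system seen in the mirror `x ↦ -x`. -/
def reflect : CoeffSystem V L k where
  x := -S.x
  e := -S.e
  f := S.f
  G := S.G
  J := S.J
  K := S.K
  h := S.h
  c := S.c
  three_le := S.three_le
  two_mul_le := S.two_mul_le
  x_e := by simp [S.x_e]
  x_f := by simp [S.x_f]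
  f_ne := S.f_ne
  J_ne := S.J_ne
  K_ne := S.K_ne
  h_ne := S.h_ne
  G_e p := by
    have := S.G_e (p + -S.e)
    rwa [neg_add_cancel_right, Finset.pair_comm] at this
  G_f := S.G_f
  G_local T hT := by
    rcases S.G_local T hT with h | ⟨p, rfl⟩
    · exact .inl fun p hp q hq => by simp [h p hp q hq]
    · exact .inr ⟨p + S.e, by rw [add_neg_cancel_right, Finset.pair_comm]⟩
  slab a b hc := by
    obtain ⟨m, hm⟩ := S.slab a b hc
    refine ⟨-(m + k - 1), fun y hy => ?_⟩
    obtain ⟨n, h1, h2, h3⟩ := hm y hy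
    exact ⟨-n, by omega, by omega, by simp [h3]⟩
  eqn := S.eqn

@[simp] theorem reflect_e : S.reflect.e = -S.e := rfl

/-- The site `y` lies in the plane `m`. -/
def At (m : ℤ) (y : V) : Prop := S.x y = m

variable {S} {a b T : Finset V} {m n : ℤ} {p q r s y z : V}

/-- Planes are indexed by integers but exist modulo `L`. Because `2 * k ≤ L`, indices less than `2 *
k` apart cannot be confused, so a string and its neighbours can be treated as if on an infinite
lattice. -/
theorem At.unique (hm : S.At m y) (hn : S.At n y) (h1 : m - n < 2 * k) (h2 : n - m < 2 * k) :
    m = n := by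
  have h : ((m - n : ℤ) : ZMod L) = 0 := by
    unfold At at hm hn
    push_cast
    rw [← hm, ← hn, sub_self]
  rw [ZMod.intCast_zmod_eq_zero_iff_dvd] at h
  have := S.two_mul_le
  have := Int.eq_zero_of_abs_lt_dvd h (by rw [abs_lt]; omega)
  omega

theorem At.ne (hm : S.At m y) (hn : S.At n z) (h0 : m ≠ n) (h1 : m - n < 2 * k)
    (h2 : n - m < 2 * k) : y ≠ z := by
  rintro rfl
  exact h0 (hm.unique hn h1 h2)

theorem At.add_e (hm : S.At m y) : S.At (m + 1) (y + S.e) := by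
  unfold At at *
  simp [hm, S.x_e]

theorem At.of_add_e (hm : S.At m (y + S.e)) : S.At (m - 1) y := by
  unfold At at *
  simp only [map_add, S.x_e] at hm
  push_cast
  rw [← hm, add_sub_cancel_right]

theorem At.add_f (hm : S.At m y) : S.At m (y + S.f) := by
  unfold At at *
  simp [hm, S.x_f]

theorem At.nsmul (hm : S.At m y) (i : ℕ) : S.At (m + i) (y + i • S.e) := by
  unfold At at *
  simp [hm, S.x_e]

theorem exists_at (S : CoeffSystem V L k) (y : V) : ∃ m, S.At m y :=
  ⟨(S.x y).cast, by simp [At]⟩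

theorem at_reflect : S.reflect.At m y ↔ S.At (-m) y := by
  simp [At, reflect, neg_eq_iff_eq_neg]

/-- A string with sites at distance `k` has coefficient zero. -/
theorem c_eq_zero_of_far (hy : y ∈ a ∪ b) (hz : z ∈ a ∪ b) (hym : S.At m y)
    (hzm : S.At (m + k) z) : S.c a b = 0 := by
  by_contra hc
  obtain ⟨l, hl⟩ := S.slab a b hc
  obtain ⟨n1, h1, h2, h3⟩ := hl y hy
  obtain ⟨n2, h4, h5, h6⟩ := hl z hz
  have h7 : S.At (n1 + k) z := by
    unfold At at *
    push_cast at *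
    rw [hzm, ← hym, h3]
  have := At.unique (S := S) h7 h6 (by omega) (by omega)
  omega

/-- A string with nonzero coefficient that touches the planes `m` and `m + k - 1` lies between. -/
theorem between (hc : S.c a b ≠ 0) (hy : y ∈ a ∪ b) (hz : z ∈ a ∪ b) (hym : S.At m y)
    (hzm : S.At (m + k - 1) z) (hs : s ∈ a ∪ b) : ∃ n, m ≤ n ∧ n < m + k ∧ S.At n s := by
  obtain ⟨l, hl⟩ := S.slab a b hc
  obtain ⟨n1, h1, h2, h3⟩ := hl y hy
  obtain ⟨n2, h4, h5, h6⟩ := hl z hz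
  obtain ⟨n, h8, h9, h10⟩ := hl s hs
  have h7 : S.At (n1 + k - 1) z := by
    unfold At at *
    push_cast at *
    rw [hzm, ← hym, h3]
  have := At.unique (S := S) h7 h6 (by omega) (by omega)
  refine ⟨m + (n - n1), by omega, by omega, ?_⟩
  unfold At at *
  push_cast
  rw [← hym, h3, h10]
  ring

theorem e_ne (S : CoeffSystem V L k) : p + S.e ≠ p := by
  obtain ⟨m, hm⟩ := S.exists_at p
  have := S.three_le
  exact hm.add_e.ne hm (by omega) (by omega) (by omega)

/-- The only interaction that removes all sites of an end plane `m` free of `X` is a bond. -/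
theorem eq_bond_of_clear (hG : S.G T ≠ 0) (hT : Odd (T ∩ a).card) (hpb : p ∈ b) (hpm : S.At m p)
    (hclear : ∀ y, S.At m y → y ∉ a ∧ y ∉ b ∆ T) (hprev : ∀ y ∈ a, ¬ S.At (m - 1) y) :
    T = {p, p + S.e} ∧ p + S.e ∈ a ∧ ∀ y ∈ b, S.At m y → y = p := by
  have h3 := S.three_le
  have hpT : p ∈ T := by
    have := (hclear p hpm).2
    rw [Finset.mem_symmDiff] at this
    tauto
  -- An interaction within one plane would lie entirely in plane `m`, where there is no `X`, and so
  -- would commute with the string.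
  rcases S.G_local T hG with h | ⟨q, rfl⟩
  · exfalso
    have : T ∩ a = ∅ := by
      rw [Finset.eq_empty_iff_forall_notMem]
      intro y hy
      rw [Finset.mem_inter] at hy
      refine (hclear y ?_).1 hy.2
      unfold At at *
      rw [← hpm, h y hy.1 p hpT]
    simp [this] at hT
  · rw [odd_card_pair_inter S.e_ne.symm] at hT
    rw [Finset.mem_insert, Finset.mem_singleton] at hpT
    rcases hpT with rfl | rfl
    · refine ⟨rfl, ?_, fun y hy hym => ?_⟩
      · have := (hclear p hpm).1
        tauto
      · have := (hclear y hym).2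
        have hne : y ≠ p + S.e := hym.ne hpm.add_e (by omega) (by omega) (by omega)
        rw [Finset.mem_symmDiff, Finset.mem_insert, Finset.mem_singleton] at this
        tauto
    -- The bond entering plane `m` from outside would need an `X` on plane `m - 1`.
    · have h1 := (hclear _ hpm).1
      have h2 : q ∉ a := fun hq => hprev q hq hpm.of_add_e
      tauto

/-- Mirror image of `eq_bond_of_clear`. -/
theorem eq_bond_of_clear_right (hG : S.G T ≠ 0) (hT : Odd (T ∩ a).card) (hpb : p + S.e ∈ b)
    (hpm : S.At m p) (hclear : ∀ y, S.At (m + 1) y → y ∉ a ∧ y ∉ b ∆ T)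
    (hnext : ∀ y ∈ a, ¬ S.At (m + 2) y) :
    T = {p, p + S.e} ∧ p ∈ a ∧ ∀ y ∈ b, S.At (m + 1) y → y = p + S.e := by
  have key := eq_bond_of_clear (S := S.reflect) (m := -(m + 1)) hG hT hpb
    (by rw [at_reflect, neg_neg]; exact hpm.add_e)
    (by simpa only [at_reflect, neg_neg] using hclear)
    (by
      have : -(-(m + 1) - 1) = m + 2 := by ring
      simpa only [at_reflect, this] using hnext)
  simpa only [at_reflect, reflect_e, neg_neg, add_neg_cancel_right, Finset.pair_comm] using key

/-! ### Shape of the strings of width `k` with an `X` on an end plane. -/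

/-- A string with an `X` on its last plane can be shifted by one bond at each end, and its first
plane is a single `Z`. -/
theorem shift_of_mem_last (hc : S.c a b ≠ 0) (hp : p ∈ a) (hpm : S.At (m + k - 1) p)
    (hq : q ∈ a ∪ b) (hqm : S.At m q) :
    (∀ y, S.At m y → y ∉ a ∧ (y ∈ b ↔ y = q)) ∧ q + S.e ∈ a ∧
      S.c a (b ∆ {p, p + S.e} ∆ {q, q + S.e}) = -S.c a b := by
  have h3 := S.three_le
  have hbt := fun {s} => between (s := s) hc hq (Finset.mem_union_left b hp) hqm hpm
  have hpe : S.At (m + k) (p + S.e) := by simpa using hpm.add_e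
  have hout : ∀ y l, S.At l y → m - 2 ≤ l → l ≤ m + k + 1 → (l < m ∨ m + k ≤ l) →
      y ∉ a ∧ y ∉ b := by
    intro y l hl h1 h2 h4
    have : y ∉ a ∪ b := by
      intro hy
      obtain ⟨n, h5, h6, h7⟩ := hbt hy
      have := hl.unique h7 (by omega) (by omega)
      omega
    simpa using this
  have hpea := (hout _ _ hpe (by omega) (by omega) (by omega)).1
  have hpeb := (hout _ _ hpe (by omega) (by omega) (by omega)).2
  have hplane : ∀ y, S.At m y → y ≠ p ∧ y ≠ p + S.e := fun y hy =>
    ⟨hy.ne hpm (by omega) (by omega) (by omega), hy.ne hpe (by omega) (by omega) (by omega)⟩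
  -- Target string: the given one lengthened by the bond at its last `X`, hence of width `k + 1`.
  -- Only operations that shorten it again can contribute to its equation.
  set b₁ := b ∆ {p, p + S.e} with hb₁
  have hmem : ∀ y, y ∈ b₁ ↔ ¬ (y ∈ b ↔ (y = p ∨ y = p + S.e)) := by
    intro y
    rw [hb₁, Finset.mem_symmDiff, Finset.mem_insert, Finset.mem_singleton]
    tauto
  have hpb₁ : p + S.e ∈ b₁ := by
    rw [hmem]
    tauto
  have hq₁ : q ∈ a ∪ b₁ := by
    have := hplane q hqm
    simp only [Finset.mem_union, hmem] at hq ⊢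
    tauto
  -- The field changes only the `X` factor at a site that keeps its `Z`, so both ends remain
  -- occupied, at distance `k`.
  have hrhs : ∑ s ∈ b₁, S.c (a ∆ {s}) b₁ = 0 := by
    refine Finset.sum_eq_zero fun s hs => c_eq_zero_of_far (y := q) (z := p + S.e) ?_
      (Finset.mem_union_right _ hpb₁) hqm hpe
    rw [Finset.mem_union] at hq₁ ⊢
    rw [Finset.mem_symmDiff, Finset.mem_singleton]
    by_cases hqs : q = s
    · exact .inr (hqs ▸ hs)
    · tauto
  have heq := S.eqn a b₁
  rw [hrhs, mul_zero] at heq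
  have hodd : Odd (({p, p + S.e} : Finset V) ∩ a).card := by
    rw [odd_card_pair_inter S.e_ne.symm]
    tauto
  have hback : b₁ ∆ {p, p + S.e} = b := by rw [hb₁, symmDiff_symmDiff_cancel_right]
  -- No interaction other than the bond just added removes `p + S.e`, so it has to clear the first
  -- plane instead.
  have hterm : ∀ T, Odd (T ∩ a).card → T ≠ {p, p + S.e} → S.G T * S.c a (b₁ ∆ T) ≠ 0 →
      (∀ y, S.At m y → y ∉ a) ∧ T = {q, q + S.e} ∧ q + S.e ∈ a ∧
        q ∈ b₁ ∧ ∀ y ∈ b₁, S.At m y → y = q := by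
    intro T hT hne h0
    have hG := left_ne_zero_of_mul h0
    have hcT := right_ne_zero_of_mul h0
    have hpT : p + S.e ∉ T := by
      intro hpT
      rcases S.G_local T hG with h | ⟨s, rfl⟩
      · have : T ∩ a = ∅ := by
          rw [Finset.eq_empty_iff_forall_notMem]
          intro y hy
          rw [Finset.mem_inter] at hy
          refine (hout y (m + k) ?_ (by omega) (by omega) (by omega)).1 hy.2
          unfold At at *
          rw [← hpe, h y hy.1 _ hpT]
        simp [this] at hT
      · rw [Finset.mem_insert, Finset.mem_singleton] at hpT
        rcases hpT with rfl | hps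
        · rw [odd_card_pair_inter S.e_ne.symm] at hT
          have := (hout _ _ hpe.add_e (by omega) (by omega) (by omega)).1
          tauto
        · exact hne (by rw [add_right_cancel hps])
    have hclear : ∀ y, S.At m y → y ∉ a ∧ y ∉ b₁ ∆ T := by
      intro y hy
      rw [← not_or, ← Finset.mem_union]
      intro hy'
      refine hcT (c_eq_zero_of_far hy' (z := p + S.e) ?_ hy hpe)
      rw [Finset.mem_union, Finset.mem_symmDiff]
      tauto
    have hqb : q ∈ b₁ := by
      have := (hclear q hqm).1
      rw [Finset.mem_union] at hq₁
      tauto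
    obtain ⟨h4, h5, h6⟩ := eq_bond_of_clear hG hT hqb hqm hclear
      fun y hy hym => (hout y _ hym (by omega) (by omega) (by omega)).1 hy
    exact ⟨fun y hy => (hclear y hy).1, h4, h5, hqb, h6⟩
  obtain ⟨T, hTodd, hTne, hT0⟩ : ∃ T, Odd (T ∩ a).card ∧ T ≠ {p, p + S.e} ∧
      S.G T * S.c a (b₁ ∆ T) ≠ 0 := by
    by_contra! hcon
    rw [Finset.sum_eq_single {p, p + S.e}] at heq
    · rw [hback, S.G_e] at heq
      exact mul_ne_zero S.J_ne hc heq
    · intro T hT hne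
      exact hcon T (by simpa using hT) hne
    · intro hT
      simp [hodd] at hT
  obtain ⟨ha, rfl, hqa, hqb, hb⟩ := hterm T hTodd hTne hT0
  refine ⟨fun y hy => ⟨ha y hy, ?_⟩, hqa, ?_⟩
  · have := hplane y hy
    have h4 := hb y
    have h5 : y = q → y ∈ b₁ := fun h => h ▸ hqb
    rw [hmem] at h4 h5
    tauto
  · rw [Finset.sum_eq_add _ _ hTne.symm] at heq
    · rw [hback, S.G_e, S.G_e, ← mul_add] at heq
      exact eq_neg_of_add_eq_zero_right ((mul_eq_zero.mp heq).resolve_left S.J_ne)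
    · intro T hT hne
      by_contra h0
      exact hne.2 (hterm T (by simpa using hT) hne.1 h0).2.1
    · intro hT
      simp [hodd] at hT
    · intro hT
      simp [hTodd] at hT

/-- An `X` on the last plane forces the first plane to be a lone `Z`. -/
theorem c_eq_zero_of_mem_both_ends (hp : p ∈ a) (hpm : S.At m p) (hq : q ∈ a)
    (hqm : S.At (m + k - 1) q) : S.c a b = 0 := by
  by_contra hc
  exact ((shift_of_mem_last hc hq hqm (Finset.mem_union_left b hp) hpm).1 p hpm).1 hp

/-- A string with an `X` on its first plane and a `Z` on its last one has a `Y` on its first plane,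
and the two ends can be rotated together. -/
theorem rotate_ends (hc : S.c a b ≠ 0) (hp : p ∈ a) (hpm : S.At m p) (hqa : q ∉ a) (hqb : q ∈ b)
    (hqm : S.At (m + k - 1) q) :
    p ∈ b ∧ (∀ y ∈ a, S.At m y → y = p) ∧ S.c (a ∆ {q} ∆ {p}) b = -S.c a b := by
  have h3 := S.three_le
  have hne : p ≠ q := hpm.ne hqm (by omega) (by omega) (by omega)
  -- In the target both end planes carry an `X`, which `Z`-interactions cannot remove, so the left
  -- side vanishes. On the right, a flip must remove the `X` at `q` or the only `X` of the first
  -- plane.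
  have heq := S.eqn (a ∆ {q}) b
  have hmem : ∀ y, y ∈ a ∆ {q} ↔ y ∈ a ∨ y = q := by
    intro y
    rw [Finset.mem_symmDiff, Finset.mem_singleton]
    have : y = q → y ∉ a := fun h => h ▸ hqa
    tauto
  rw [Finset.sum_eq_zero, zero_eq_mul, or_iff_right S.h_ne] at heq
  · have hterm : ∀ s ∈ b, s ≠ q → S.c (a ∆ {q} ∆ {s}) b ≠ 0 →
        s = p ∧ ∀ y ∈ a, S.At m y → y = p := by
      intro s hs hsq h0
      have key : ∀ y ∈ a, S.At m y → y = s := by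
        intro y hy hym
        by_contra hys
        refine h0 (c_eq_zero_of_mem_both_ends (p := y) (q := q) ?_ hym ?_ hqm) <;>
        · rw [Finset.mem_symmDiff, hmem, Finset.mem_singleton]
          tauto
      have hps := key p hp hpm
      exact ⟨hps.symm, hps ▸ key⟩
    have hself : a ∆ {q} ∆ {q} = a := symmDiff_symmDiff_cancel_right _ _
    obtain ⟨s, hs, hsq, h0⟩ : ∃ s ∈ b, s ≠ q ∧ S.c (a ∆ {q} ∆ {s}) b ≠ 0 := by
      by_contra! hcon
      rw [Finset.sum_eq_single_of_mem q hqb hcon, hself] at heq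
      exact hc heq
    obtain ⟨rfl, huniq⟩ := hterm s hs hsq h0
    refine ⟨hs, huniq, ?_⟩
    rw [Finset.sum_eq_add_of_mem q s hqb hs hsq.symm, hself] at heq
    · exact eq_neg_of_add_eq_zero_right heq
    · intro t ht htn
      by_contra h
      exact htn.2 (hterm t ht htn.1 h).1
  · intro T _
    rw [c_eq_zero_of_mem_both_ends (p := p) (q := q) _ hpm _ hqm, mul_zero] <;>
    · rw [hmem]
      tauto

/-- A string with an `X` on its last plane can be translated, and its second plane is a single
`X`. -/
theorem translate_of_mem_last (hc : S.c a b ≠ 0) (hp : p ∈ a) (hpm : S.At (m + k - 1) p)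
    (hq : q ∈ a ∪ b) (hqm : S.At m q) :
    (∀ y, S.At m y → y ∉ a ∧ (y ∈ b ↔ y = q)) ∧
      (∀ y, S.At (m + 1) y → (y ∈ a ↔ y = q + S.e) ∧ y ∉ b) ∧
      S.c a (b ∆ {p, p + S.e} ∆ {q, q + S.e}) = -S.c a b ∧
      S.c (a ∆ {p + S.e} ∆ {q + S.e}) (b ∆ {p, p + S.e} ∆ {q, q + S.e}) = S.c a b := by
  have h3 := S.three_le
  obtain ⟨h1, h2, h4⟩ := shift_of_mem_last hc hp hpm hq hqm
  have hpe : S.At (m + 1 + k - 1) (p + S.e) := by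
    have := hpm.add_e
    rwa [show m + k - 1 + 1 = m + 1 + k - 1 by ring] at this
  have hqe := hqm.add_e
  have hpea : p + S.e ∉ a := by
    intro h
    obtain ⟨n, h5, h6, h7⟩ := between hc hq (Finset.mem_union_left b hp) hqm hpm
      (Finset.mem_union_left b h)
    have := hpe.unique h7 (by omega) (by omega)
    omega
  have hpeb : p + S.e ∉ b := by
    intro h
    obtain ⟨n, h5, h6, h7⟩ := between hc hq (Finset.mem_union_left b hp) hqm hpm
      (Finset.mem_union_right a h)
    have := hpe.unique h7 (by omega) (by omega)
    omega
  have hpn : p ≠ p + S.e := S.e_ne.symm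
  have hpq : q ≠ p + S.e := hqm.ne hpe (by omega) (by omega) (by omega)
  have hpqe : p + S.e ≠ q + S.e := hpe.ne hqe (by omega) (by omega) (by omega)
  -- The shifted string has an `X` at its new start `q + S.e` and a bare `Z` at its new end `p +
  -- S.e`, so its ends can be rotated. This restores an `X` at the end, and the two signs cancel.
  set b₂ := b ∆ {p, p + S.e} ∆ {q, q + S.e} with hb₂
  have hc₂ : S.c a b₂ ≠ 0 := by rw [h4]; exact neg_ne_zero.mpr hc
  have hmem : p + S.e ∈ b₂ := by
    simp only [hb₂, Finset.mem_symmDiff, Finset.mem_insert, Finset.mem_singleton]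
    tauto
  obtain ⟨h5, h6, h7⟩ := rotate_ends hc₂ h2 hqe hpea hmem hpe
  have h8 : S.c (a ∆ {p + S.e} ∆ {q + S.e}) b₂ = S.c a b := by rw [h7, h4, neg_neg]
  refine ⟨h1, fun y hy => ⟨⟨fun h => h6 y h hy, fun h => h ▸ h2⟩, fun hyb => ?_⟩, h4, h8⟩
  -- The first plane of the translated string is a lone `Z` at `q + S.e`. On that plane the
  -- translation toggled only this `Z`, so `b` had none there.
  have key := (shift_of_mem_last (h8 ▸ hc) (p := p + S.e) (m := m + 1) (q := q + S.e) ?_ hpe ?_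
    hqe).1 y hy
  · have h9 : y ≠ p := hy.ne hpm (by omega) (by omega) (by omega)
    have h10 : y ≠ p + S.e := hy.ne hpe (by omega) (by omega) (by omega)
    have h11 : y ≠ q := hy.ne hqm (by omega) (by omega) (by omega)
    have h12 := key.2
    simp only [hb₂, Finset.mem_symmDiff, Finset.mem_insert, Finset.mem_singleton] at h12
    tauto
  · simp only [Finset.mem_symmDiff, Finset.mem_singleton]
    tauto
  · exact Finset.mem_union_right _ h5

/-- The sites `p, p + e, …, p + (n - 1) e`. -/
def seg (S : CoeffSystem V L k) (p : V) (n : ℕ) : Finset V :=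
  (Finset.range n).image fun i => p + i • S.e

theorem mem_seg {n : ℕ} : y ∈ S.seg p n ↔ ∃ i < n, y = p + i • S.e := by
  simp [seg, eq_comm]

theorem At.mem_seg_iff {n j : ℕ} (hp : S.At m p) (hy : S.At (m + j) y) (hj : j < 2 * k)
    (hn : n ≤ 2 * k) : y ∈ S.seg p n ↔ j < n ∧ y = p + j • S.e := by
  rw [mem_seg]
  constructor
  · rintro ⟨i, hi, rfl⟩
    have := hy.unique (hp.nsmul i) (by omega) (by omega)
    obtain rfl : j = i := by omega
    exact ⟨hi, rfl⟩
  · rintro ⟨h1, h2⟩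
    exact ⟨j, h1, h2⟩

/-- If strings can be translated as long as their second plane is a single `X`, then their inner
planes form a line of `X`. -/
theorem inner_line_of_translate (N : ℤ → Finset V → Finset V → V → Prop)
    (hN : ∀ m a b q, N m a b q →
      (∀ y, S.At (m + 1) y → (y ∈ a ↔ y = q + S.e) ∧ y ∉ b) ∧
      ∃ a' b', N (m + 1) a' b' (q + S.e) ∧ ∀ y n, m + 2 ≤ n → n ≤ m + k - 2 → S.At n y →
        (y ∈ a' ↔ y ∈ a) ∧ (y ∈ b' ↔ y ∈ b)) (j : ℕ) :
    ∀ m a b q, N m a b q → j + 1 ≤ k - 2 → ∀ y, S.At (m + (j + 1 : ℕ)) y →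
      (y ∈ a ↔ y = q + (j + 1) • S.e) ∧ y ∉ b := by
  induction j with
  | zero =>
    intro m a b q h _ y hy
    simpa using (hN m a b q h).1 y (by simpa using hy)
  | succ j ih =>
    intro m a b q h hj y hy
    obtain ⟨a', b', h', hab⟩ := (hN m a b q h).2
    -- Translation does not touch this plane, and in the translated string it lies one step closer
    -- to the start.
    have h1 := hab y _ (by omega) (by omega) hy
    have h2 := ih (m + 1) a' b' (q + S.e) h' (by omega) y
      (by convert hy using 1; push_cast; ring)
    rw [← h1.1, ← h1.2, h2.1, add_assoc, ← succ_nsmul']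
    exact ⟨Iff.rfl, h2.2⟩

theorem notMem_of_outside {l : ℤ} (hc : S.c a b ≠ 0) (hq : q ∈ a ∪ b) (hp : p ∈ a ∪ b)
    (hqm : S.At m q) (hpm : S.At (m + k - 1) p) (hy : S.At l y) (h1 : m - 3 ≤ l)
    (h2 : l ≤ m + k + 2) (h : l < m ∨ m + k ≤ l) : y ∉ a ∧ y ∉ b := by
  have h3 := S.three_le
  rw [← not_or, ← Finset.mem_union]
  intro hyab
  obtain ⟨n, h4, h5, h6⟩ := between hc hq hp hqm hpm hyab
  have := hy.unique h6 (by omega) (by omega)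
  omega

/-- Two sets of sites between the planes `m` and `m + k - 1` agree if they agree on each plane. -/
theorem eq_of_planes {a₀ : Finset V} (h : ∀ y ∈ a, ∃ n, m ≤ n ∧ n < m + k ∧ S.At n y)
    (h₀ : ∀ y ∈ a₀, ∃ n, m ≤ n ∧ n < m + k ∧ S.At n y)
    (hp : ∀ j : ℕ, j < k → ∀ y, S.At (m + j) y → (y ∈ a ↔ y ∈ a₀)) : a = a₀ := by
  ext y
  constructor
  · intro hy
    obtain ⟨n, h1, h2, h3⟩ := h y hy
    obtain ⟨j, rfl⟩ : ∃ j : ℕ, n = m + j := ⟨(n - m).toNat, by omega⟩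
    exact (hp j (by omega) y h3).1 hy
  · intro hy
    obtain ⟨n, h1, h2, h3⟩ := h₀ y hy
    obtain ⟨j, rfl⟩ : ∃ j : ℕ, n = m + j := ⟨(n - m).toNat, by omega⟩
    exact (hp j (by omega) y h3).2 hy

theorem At.seg_between {i l : ℕ} (hq : S.At m q) (h : i + l ≤ k) :
    ∀ y ∈ S.seg (q + i • S.e) l, ∃ n, m ≤ n ∧ n < m + k ∧ S.At n y := by
  intro y hy
  rw [mem_seg] at hy
  obtain ⟨j, hj, rfl⟩ := hy
  exact ⟨_, by omega, by omega, (hq.nsmul i).nsmul j⟩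

theorem At.ends_between (hq : S.At m q) :
    ∀ y ∈ ({q, q + (k - 1) • S.e} : Finset V), ∃ n, m ≤ n ∧ n < m + k ∧ S.At n y := by
  intro y hy
  have h3 := S.three_le
  rw [Finset.mem_insert, Finset.mem_singleton] at hy
  rcases hy with rfl | rfl
  · exact ⟨m, by omega, by omega, hq⟩
  · exact ⟨_, by omega, by omega, hq.nsmul _⟩

theorem At.mem_ends_iff {j : ℕ} (hq : S.At m q) (hy : S.At (m + j) y) (hj : j < k) :
    y ∈ ({q, q + (k - 1) • S.e} : Finset V) ↔
      (j = 0 ∧ y = q) ∨ (j = k - 1 ∧ y = q + (k - 1) • S.e) := by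
  have h3 := S.three_le
  rw [Finset.mem_insert, Finset.mem_singleton]
  constructor
  · rintro (rfl | rfl)
    · have := hy.unique hq (by omega) (by omega)
      exact .inl ⟨by omega, rfl⟩
    · have := hy.unique (hq.nsmul _) (by omega) (by omega)
      exact .inr ⟨by omega, rfl⟩
  · tauto

/-- A string of width `k` with an `X` on its last plane is `Z X … X Y` on a line. -/
theorem line_of_mem_last (hc : S.c a b ≠ 0) (hp : p ∈ a) (hpm : S.At (m + k - 1) p)
    (hq : q ∈ a ∪ b) (hqm : S.At m q) :
    a = S.seg (q + 1 • S.e) (k - 1) ∧ b = {q, q + (k - 1) • S.e} := by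
  have h3 := S.three_le
  let N : ℤ → Finset V → Finset V → V → Prop := fun m a b q =>
    S.c a b ≠ 0 ∧ (∃ p ∈ a, S.At (m + k - 1) p) ∧ q ∈ a ∪ b ∧ S.At m q
  have hstep : ∀ m a b q p, S.c a b ≠ 0 → p ∈ a → S.At (m + k - 1) p → q ∈ a ∪ b → S.At m q →
      N (m + 1) (a ∆ {p + S.e} ∆ {q + S.e}) (b ∆ {p, p + S.e} ∆ {q, q + S.e}) (q + S.e) := by
    intro m a b q p hc hp hpm hq hqm
    obtain ⟨h1, h2, h4, h5⟩ := translate_of_mem_last hc hp hpm hq hqm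
    have hpe : S.At (m + 1 + k - 1) (p + S.e) := by
      have := hpm.add_e
      rwa [show m + k - 1 + 1 = m + 1 + k - 1 by ring] at this
    have hpea := notMem_of_outside hc hq (Finset.mem_union_left b hp) hqm hpm hpe (by omega)
      (by omega) (by omega)
    have hpqe : p + S.e ≠ q + S.e := hpe.ne hqm.add_e (by omega) (by omega) (by omega)
    have hqb := (h2 _ hqm.add_e).2
    have hqp : q + S.e ≠ p := hqm.add_e.ne hpm (by omega) (by omega) (by omega)
    refine ⟨h5 ▸ hc, ⟨p + S.e, ?_, hpe⟩, Finset.mem_union_right _ ?_, hqm.add_e⟩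
    · simp only [Finset.mem_symmDiff, Finset.mem_singleton]
      tauto
    · simp only [Finset.mem_symmDiff, Finset.mem_singleton, Finset.mem_insert]
      tauto
  have hline := inner_line_of_translate (S := S) N (by
    rintro m a b q ⟨hc, ⟨p, hp, hpm⟩, hq, hqm⟩
    refine ⟨(translate_of_mem_last hc hp hpm hq hqm).2.1, _, _,
      hstep m a b q p hc hp hpm hq hqm, fun y n h1 h2 hy => ?_⟩
    have e1 : y ≠ p := hy.ne hpm (by omega) (by omega) (by omega)
    have e2 : y ≠ p + S.e := hy.ne hpm.add_e (by omega) (by omega) (by omega)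
    have e3 : y ≠ q := hy.ne hqm (by omega) (by omega) (by omega)
    have e4 : y ≠ q + S.e := hy.ne hqm.add_e (by omega) (by omega) (by omega)
    simp only [Finset.mem_symmDiff, Finset.mem_singleton, Finset.mem_insert]
    tauto)
  have hbt := fun {s} => between (s := s) hc hq (Finset.mem_union_left b hp) hqm hpm
  have hfirst := (translate_of_mem_last hc hp hpm hq hqm).1
  have hinner : ∀ j : ℕ, 0 < j → j < k - 1 → ∀ y, S.At (m + j) y →
      (y ∈ a ↔ y = q + j • S.e) ∧ y ∉ b := by
    intro j h1 h2 y hy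
    obtain ⟨i, rfl⟩ : ∃ i, j = i + 1 := ⟨j - 1, by omega⟩
    exact hline i m a b q ⟨hc, ⟨p, hp, hpm⟩, hq, hqm⟩ (by omega) y hy
  have hlast : ∀ y, S.At (m + (k - 1 : ℕ)) y →
      (y ∈ a ↔ y = q + (k - 1) • S.e) ∧ (y ∈ b ↔ y = p) := by
    intro y hy
    -- The last plane is the penultimate plane of the translated string, hence a lone `X` there;
    -- undoing the translation restores the `Z` at `p`.
    have h1 := hline (k - 3) _ _ _ _ (hstep m a b q p hc hp hpm hq hqm) (by omega) y
      (by convert hy using 1; omega)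
    rw [add_assoc, ← succ_nsmul', show k - 3 + 1 + 1 = k - 1 by omega] at h1
    have e2 : y ≠ p + S.e := hy.ne hpm.add_e (by omega) (by omega) (by omega)
    have e3 : y ≠ q := hy.ne hqm (by omega) (by omega) (by omega)
    have e4 : y ≠ q + S.e := hy.ne hqm.add_e (by omega) (by omega) (by omega)
    simp only [Finset.mem_symmDiff, Finset.mem_singleton, Finset.mem_insert] at h1
    tauto
  have hpq : p = q + (k - 1) • S.e := (hlast p (by convert hpm using 1; omega)).1.1 hp
  constructor
  · refine eq_of_planes (fun y hy => hbt (Finset.mem_union_left b hy))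
      (hqm.seg_between (by omega)) fun j hj y hy => ?_
    rcases Nat.eq_zero_or_pos j with rfl | h0
    · have := (hfirst y (by simpa using hy)).1
      simp only [this, false_iff]
      intro hmem
      obtain ⟨i, hi, rfl⟩ := mem_seg.1 hmem
      have := hy.unique ((hqm.nsmul 1).nsmul i) (by omega) (by omega)
      omega
    · rw [At.mem_seg_iff (j := j - 1) (hqm.nsmul 1) (by convert hy using 1; omega) (by omega)
        (by omega), add_assoc, ← add_nsmul, show 1 + (j - 1) = j by omega]
      rcases (show j < k - 1 ∨ j = k - 1 by omega) with h | rfl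
      · rw [(hinner j h0 h y hy).1]
        exact ⟨fun h => ⟨by omega, h⟩, fun h => h.2⟩
      · rw [(hlast y hy).1]
        exact ⟨fun h => ⟨by omega, h⟩, fun h => h.2⟩
  · refine eq_of_planes (fun y hy => hbt (Finset.mem_union_right a hy)) hqm.ends_between
      fun j hj y hy => ?_
    rw [hqm.mem_ends_iff hy hj]
    rcases Nat.eq_zero_or_pos j with rfl | h0
    · rw [(hfirst y (by simpa using hy)).2]
      have : 0 ≠ k - 1 := by omega
      simp [this]
    · rcases (show j < k - 1 ∨ j = k - 1 by omega) with h | rfl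
      · have h4 := (hinner j h0 h y hy).2
        have h5 : j ≠ k - 1 := by omega
        have h6 : j ≠ 0 := by omega
        simp [h4, h5, h6]
      · rw [(hlast y hy).2, hpq]
        have h6 : k - 1 ≠ 0 := by omega
        simp [h6]

theorem seg_reflect {l : ℕ} : S.reflect.seg (q + l • S.e) (l + 1) = S.seg q (l + 1) := by
  ext y
  simp only [mem_seg, reflect_e]
  constructor
  · rintro ⟨i, hi, rfl⟩
    obtain ⟨j, rfl⟩ : ∃ j, l = i + j := ⟨l - i, by omega⟩
    exact ⟨j, by omega, by rw [add_nsmul, smul_neg]; abel⟩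
  · rintro ⟨i, hi, rfl⟩
    obtain ⟨j, rfl⟩ : ∃ j, l = i + j := ⟨l - i, by omega⟩
    exact ⟨j, by omega, by rw [add_nsmul, smul_neg]; abel⟩

/-- The coefficient of `Z X … X Y` is invariant under translation. -/
theorem c_last_line_translate (hqm : S.At m q)
    (hc : S.c (S.seg (q + 1 • S.e) (k - 1)) {q, q + (k - 1) • S.e} ≠ 0) :
    S.c (S.seg (q + S.e + 1 • S.e) (k - 1)) {q + S.e, q + S.e + (k - 1) • S.e} =
      S.c (S.seg (q + 1 • S.e) (k - 1)) {q, q + (k - 1) • S.e} ∧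
    S.c (S.seg (q + 1 • S.e) (k - 1)) {q + S.e, q + S.e + (k - 1) • S.e} =
      -S.c (S.seg (q + 1 • S.e) (k - 1)) {q, q + (k - 1) • S.e} := by
  have h3 := S.three_le
  set a := S.seg (q + 1 • S.e) (k - 1) with ha
  set p := q + (k - 1) • S.e with hp
  have hpm : S.At (m + k - 1) p := by convert hqm.nsmul (k - 1) using 1; omega
  have hpa : p ∈ a := by
    rw [ha, mem_seg]
    exact ⟨k - 2, by omega, by rw [hp, show k - 1 = 1 + (k - 2) by omega, add_nsmul, add_assoc]⟩
  obtain ⟨h1, h2, h4, h5⟩ := translate_of_mem_last hc hpa hpm (by simp) hqm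
  have hpe : S.At (m + 1 + k - 1) (p + S.e) := by
    have := hpm.add_e
    rwa [show m + k - 1 + 1 = m + 1 + k - 1 by ring] at this
  have hpea := notMem_of_outside hc (q := q) (by simp) (Finset.mem_union_left _ hpa) hqm hpm hpe
    (by omega) (by omega) (by omega)
  have hpqe : p + S.e ≠ q + S.e := hpe.ne hqm.add_e (by omega) (by omega) (by omega)
  have hqp : q + S.e ≠ p := hqm.add_e.ne hpm (by omega) (by omega) (by omega)
  have hqpe : q ≠ p + S.e := hqm.ne hpe (by omega) (by omega) (by omega)
  have hpq : p ≠ q := hpm.ne hqm (by omega) (by omega) (by omega)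
  have hpp : p ≠ p + S.e := S.e_ne.symm
  have hqq : q ≠ q + S.e := S.e_ne.symm
  have hb : ({q, p} : Finset V) ∆ {p, p + S.e} ∆ {q, q + S.e} = {q + S.e, p + S.e} := by
    ext y
    simp only [Finset.mem_symmDiff, Finset.mem_singleton, Finset.mem_insert]
    grind
  have hcomm : q + S.e + (k - 1) • S.e = p + S.e := by rw [hp]; abel
  rw [hb] at h4 h5
  rw [hcomm]
  refine ⟨?_, h4⟩
  obtain ⟨h6, -⟩ := line_of_mem_last (h5 ▸ hc) (p := p + S.e) (m := m + 1) (q := q + S.e)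
    (by
      simp only [Finset.mem_symmDiff, Finset.mem_singleton]
      tauto) hpe (by simp) hqm.add_e
  rw [h6] at h5
  exact h5

/-! ### Decoration in the transverse direction, and exclusion of `Z X … X Y`. -/

theorem nsmul_inj {i j : ℕ} (hi : i < 2 * k) (hj : j < 2 * k) :
    q + i • S.e = q + j • S.e ↔ i = j := by
  refine ⟨fun h => ?_, fun h => h ▸ rfl⟩
  obtain ⟨m, hm⟩ := S.exists_at q
  have := (hm.nsmul i).unique (h ▸ hm.nsmul j) (by omega) (by omega)
  omega

/-- The translation `f` is nonzero and stays inside a plane, and the line meets each plane in range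
only once. -/
theorem nsmul_ne_add_f {i j : ℕ} (hi : i < 2 * k) (hj : j < 2 * k) :
    q + i • S.e ≠ q + j • S.e + S.f := by
  intro h
  obtain ⟨m, hm⟩ := S.exists_at q
  have := (hm.nsmul i).unique (h ▸ (hm.nsmul j).add_f) (by omega) (by omega)
  obtain rfl : i = j := by omega
  exact S.f_ne (by simpa using h)

theorem self_ne_nsmul {i : ℕ} (h0 : i ≠ 0) (hi : i < 2 * k) : q ≠ q + i • S.e := by
  intro h
  have := (nsmul_inj (S := S) (q := q) (i := 0) (by omega) hi).1 (by simpa using h)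
  omega

theorem self_ne_add_f {j : ℕ} (hj : j < 2 * k) : q ≠ q + j • S.e + S.f := by
  have h3 := S.three_le
  have := nsmul_ne_add_f (S := S) (q := q) (i := 0) (j := j) (by omega) hj
  simpa using this

theorem nsmul_mem_seg {i l n : ℕ} (hi : i < 2 * k) (hn : l + n ≤ 2 * k) :
    q + i • S.e ∈ S.seg (q + l • S.e) n ↔ l ≤ i ∧ i < l + n := by
  rw [mem_seg]
  constructor
  · rintro ⟨t, ht, h⟩
    rw [add_assoc, ← add_nsmul, nsmul_inj hi (by omega)] at h
    omega
  · rintro ⟨h1, h2⟩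
    exact ⟨i - l, by omega, by rw [add_assoc, ← add_nsmul, Nat.add_sub_cancel' h1]⟩

theorem add_f_notMem_seg {j l n : ℕ} (hj : j < 2 * k) (hn : l + n ≤ 2 * k) :
    q + j • S.e + S.f ∉ S.seg (q + l • S.e) n := by
  rw [mem_seg]
  rintro ⟨t, ht, h⟩
  rw [add_assoc q (l • S.e), ← add_nsmul] at h
  exact nsmul_ne_add_f (by omega) hj h.symm

theorem self_notMem_seg {l n : ℕ} (h0 : 0 < l) (hn : l + n ≤ 2 * k) :
    q ∉ S.seg (q + l • S.e) n := by
  have := S.three_le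
  have h := (nsmul_mem_seg (S := S) (q := q) (i := 0) (by omega) hn).not.2 (by omega)
  simpa using h

theorem seg_succ_symmDiff {i l : ℕ} (h : i + l < 2 * k) :
    S.seg (q + i • S.e) (l + 1) ∆ {q + (i + l) • S.e} = S.seg (q + i • S.e) l := by
  ext y
  rw [Finset.mem_symmDiff, Finset.mem_singleton]
  have h1 : y ∈ S.seg (q + i • S.e) (l + 1) ↔
      y ∈ S.seg (q + i • S.e) l ∨ y = q + (i + l) • S.e := by
    simp only [mem_seg, Nat.lt_succ_iff_lt_or_eq, or_and_right, exists_or, exists_eq_left,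
      add_nsmul, add_assoc]
  have h2 : y = q + (i + l) • S.e → y ∉ S.seg (q + i • S.e) l := by
    rintro rfl
    rw [nsmul_mem_seg h (by omega)]
    omega
  tauto

/-- The equation at `Z X … X Y` decorated by a bond in the direction `f`. -/
theorem decorated_last (S : CoeffSystem V L k) (q : V) {j : ℕ} (h1 : 1 ≤ j) (hj : j ≤ k - 1) :
    S.J * S.c (S.seg (q + 1 • S.e) (k - 1))
        ({q + 1 • S.e, q + (k - 1) • S.e} ∆ {q + j • S.e, q + j • S.e + S.f}) +
      S.K * S.c (S.seg (q + 1 • S.e) (k - 1)) {q, q + (k - 1) • S.e} =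
    if j = k - 1 then 0 else
      S.h * S.c (S.seg (q + 1 • S.e) (k - 2))
        ({q, q + (k - 1) • S.e} ∆ {q + j • S.e, q + j • S.e + S.f}) := by
  have h3 := S.three_le
  obtain ⟨m, hm⟩ := S.exists_at q
  have hpm : S.At (m + k - 1) (q + (k - 1) • S.e) := by
    convert hm.nsmul (k - 1) using 1; omega
  have hpa : q + (k - 1) • S.e ∈ S.seg (q + 1 • S.e) (k - 1) := by
    rw [nsmul_mem_seg (by omega) (by omega)]; omega
  have hea : q + 1 • S.e ∈ S.seg (q + 1 • S.e) (k - 1) := by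
    rw [nsmul_mem_seg (by omega) (by omega)]; omega
  have hra : q + j • S.e ∈ S.seg (q + 1 • S.e) (k - 1) := by
    rw [nsmul_mem_seg (by omega) (by omega)]; omega
  have hfa : q + j • S.e + S.f ∉ S.seg (q + 1 • S.e) (k - 1) :=
    add_f_notMem_seg (by omega) (by omega)
  have hqa : q ∉ S.seg (q + 1 • S.e) (k - 1) := self_notMem_seg (by omega) (by omega)
  have hqf : q ≠ q + j • S.e + S.f := self_ne_add_f (by omega)
  have hqr : q ≠ q + j • S.e := self_ne_nsmul (by omega) (by omega)
  have hqp : q ≠ q + (k - 1) • S.e := self_ne_nsmul (by omega) (by omega)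
  have hq1 : q ≠ q + 1 • S.e := self_ne_nsmul (by omega) (by omega)
  have hp1 : q + (k - 1) • S.e ≠ q + 1 • S.e := by
    rw [Ne, nsmul_inj (by omega) (by omega)]
    omega
  have hpf : q + (k - 1) • S.e ≠ q + j • S.e + S.f := nsmul_ne_add_f (by omega) (by omega)
  have hpr : q + (k - 1) • S.e = q + j • S.e ↔ j = k - 1 := by
    rw [nsmul_inj (by omega) (by omega), eq_comm]
  have hseg : S.seg (q + 1 • S.e) (k - 1) ∆ {q + (k - 1) • S.e} = S.seg (q + 1 • S.e) (k - 2) := by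
    have := seg_succ_symmDiff (S := S) (q := q) (i := 1) (l := k - 2) (by omega)
    rwa [show k - 2 + 1 = k - 1 by omega, show 1 + (k - 2) = k - 1 by omega] at this
  have hplane : ∀ y n, S.At n y → m - 1 ≤ n → n ≤ m → y ∉ S.seg (q + 1 • S.e) (k - 1) := by
    intro y n hy h1 h2 hya
    obtain ⟨i, hi, rfl⟩ := mem_seg.1 hya
    have := hy.unique ((hm.nsmul 1).nsmul i) (by omega) (by omega)
    omega
  have huniq : ∀ y, S.At m y →
      S.seg (q + 1 • S.e) (k - 1) = S.seg (y + 1 • S.e) (k - 1) → y = q := by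
    intro y hy h
    rw [h, mem_seg] at hea
    obtain ⟨i, hi, h⟩ := hea
    have := (hm.nsmul 1).unique (h ▸ (hy.nsmul 1).nsmul i) (by omega) (by omega)
    obtain rfl : i = 0 := by omega
    simpa using h.symm
  generalize hag : S.seg (q + 1 • S.e) (k - 1) = a at *
  generalize hpg : q + (k - 1) • S.e = p at *
  generalize hrg : q + j • S.e = r at *
  simp only [one_nsmul] at hq1 hp1 hea ⊢
  set b : Finset V := {q, p} ∆ {r, r + S.f} with hb
  have hmem : ∀ y, y ∈ b ↔ ¬ (y = q ∨ y = p ↔ y = r ∨ y = r + S.f) := by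
    intro y
    simp only [hb, Finset.mem_symmDiff, Finset.mem_insert, Finset.mem_singleton]
    grind
  have hqb : q ∈ b := by simp [hmem, hqr, hqf]
  have hfb : r + S.f ∈ b := by simp [hmem, hqf.symm, hpf.symm]
  have heq := S.eqn a b
  -- Such a flip keeps the `X` at `p`, so the string would have to be an undecorated line, yet `r +
  -- S.f` is occupied.
  have hrhs : ∀ s ∈ b, s ≠ p → S.c (a ∆ {s}) b = 0 := by
    intro s hs hsp
    by_contra hc
    have := (line_of_mem_last hc (p := p) (q := q) (m := m) (by
      rw [Finset.mem_symmDiff, Finset.mem_singleton]; exact .inl ⟨hpa, hsp.symm⟩) hpm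
      (Finset.mem_union_right _ hqb) hm).2
    rw [this, hpg, Finset.mem_insert, Finset.mem_singleton] at hfb
    exact hfb.elim hqf.symm hpf.symm
  have hb1 : b ∆ {q, q + S.e} = {q + S.e, p} ∆ {r, r + S.f} := by
    rw [hb, symmDiff_right_comm]
    congr 1
    ext y
    simp only [Finset.mem_symmDiff, Finset.mem_insert, Finset.mem_singleton]
    clear * - hqp hq1 hp1
    grind
  have hb2 : b ∆ {r, r + S.f} = {q, p} := by rw [hb, symmDiff_symmDiff_cancel_right]
  rw [Finset.sum_eq_add {q, q + S.e} {r, r + S.f}, S.G_e, S.G_f, hb1, hb2] at heq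
  · rw [heq]
    split_ifs with hjk
    -- For `j = k - 1` the decorating bond cancels the `Z` at `p`, so the one useful flip is
    -- unavailable.
    · rw [Finset.sum_eq_zero, mul_zero]
      intro s hs
      refine hrhs s hs ?_
      rintro rfl
      rw [hmem] at hs
      simp [hpr.2 hjk] at hs
    · rw [Finset.sum_eq_single_of_mem p _ (fun s hs hsp => hrhs s hs hsp), hseg, one_nsmul]
      simp [hmem, hpr, hjk, hpf]
  · intro h
    have : q ∈ ({r, r + S.f} : Finset V) := h ▸ Finset.mem_insert_self _ _
    rw [Finset.mem_insert, Finset.mem_singleton] at this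
    exact this.elim hqr hqf
  · rintro T hT ⟨hT1, hT2⟩
    by_contra h0
    have hG := left_ne_zero_of_mul h0
    -- The result still has an `X` at `p`. Either the interaction clears the first plane, and is the
    -- bond at `q`, or the result has width `k` and is the bare line, so the interaction is the
    -- decoration.
    have hc := right_ne_zero_of_mul h0
    have hline := fun y (hy : S.At m y) (hyT : y ∈ a ∪ b ∆ T) =>
      line_of_mem_last hc hpa hpm hyT hy
    have hTb : T = b ∆ (b ∆ T) := by rw [symmDiff_symmDiff_cancel_left]
    by_cases hqT : q ∈ T
    · refine hT1 (eq_bond_of_clear hG (by simpa using hT) hqb hm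
        (fun y hy => ⟨hplane y m hy (by omega) le_rfl, ?_⟩) ?_).1
      · intro hyT
        have hyq := huniq y hy (hline y hy (Finset.mem_union_right _ hyT)).1
        subst hyq
        simp [Finset.mem_symmDiff, hqb, hqT] at hyT
      · exact fun y hy hym => hplane y _ hym (by omega) (by omega) hy
    · have := (hline q hm (by simp [Finset.mem_symmDiff, hqb, hqT])).2
      rw [hpg] at this
      rw [this, hb, symmDiff_comm, symmDiff_symmDiff_cancel_left] at hTb
      exact hT2 hTb
  · intro h
    refine absurd ?_ h
    rw [Finset.mem_filter_univ, odd_card_pair_inter hq1]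
    simp [hqa, hea]
  · intro h
    refine absurd ?_ h
    rw [Finset.mem_filter_univ, odd_card_pair_inter (fun h => S.f_ne (by simpa using h))]
    simp [hra, hfa]

/-- The equation at `Y X … X Z` decorated by a bond in the direction `f`. -/
theorem decorated_first (S : CoeffSystem V L k) (q : V) {j : ℕ} (h1 : 1 ≤ j) (hj : j ≤ k - 1) :
    S.J * S.c (S.seg (q + 1 • S.e) (k - 1))
        ({q + 1 • S.e, q + (k - 1) • S.e} ∆ {q + j • S.e, q + j • S.e + S.f}) +
      S.K * S.c (S.seg (q + 1 • S.e) (k - 1)) {q + S.e, q + S.e + (k - 1) • S.e} =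
    if j = 1 then 0 else
      S.h * S.c (S.seg (q + S.e + 1 • S.e) (k - 2))
        ({q + S.e, q + S.e + (k - 1) • S.e} ∆ {q + j • S.e, q + j • S.e + S.f}) := by
  have h3 := S.three_le
  -- Read backwards from `q + k • S.e`, the string `Y X … X Z` on `q + e, …, q + k e` is `Z X … X
  -- Y`, and position `j` becomes `k - j`.
  have key := S.reflect.decorated_last (q + k • S.e) (j := k - j) (by omega) (by omega)
  have hpt : ∀ i ≤ k, q + k • S.e + i • -S.e = q + (k - i) • S.e := by
    intro i hi
    obtain ⟨l, rfl⟩ : ∃ l, k = l + i := ⟨k - i, by omega⟩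
    rw [add_nsmul, Nat.add_sub_cancel, smul_neg]
    abel
  have e1 : S.reflect.seg (q + (k - 1) • S.e) (k - 1) = S.seg (q + 1 • S.e) (k - 1) := by
    have := seg_reflect (S := S) (q := q + 1 • S.e) (l := k - 2)
    rwa [add_assoc, ← add_nsmul, show 1 + (k - 2) = k - 1 by omega,
      show k - 2 + 1 = k - 1 by omega] at this
  have e2 : S.reflect.seg (q + (k - 1) • S.e) (k - 2) = S.seg (q + S.e + 1 • S.e) (k - 2) := by
    have := seg_reflect (S := S) (q := q + 2 • S.e) (l := k - 3)
    rw [add_assoc, ← add_nsmul, show 2 + (k - 3) = k - 1 by omega,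
      show k - 3 + 1 = k - 2 by omega] at this
    rw [this, two_nsmul, one_nsmul, add_assoc]
  have e3 : q + S.e + (k - 1) • S.e = q + k • S.e := by
    rw [add_assoc, ← succ_nsmul', show k - 1 + 1 = k by omega]
  rw [reflect_e, hpt 1 (by omega), hpt (k - 1) (by omega), hpt (k - j) (by omega), e1, e2,
    show k - (k - 1) = 1 by omega, show k - (k - j) = j by omega,
    Finset.pair_comm (q + (k - 1) • S.e), Finset.pair_comm (q + k • S.e)] at key
  rw [e3, ← one_nsmul S.e]
  simp only [show k - j = k - 1 ↔ j = 1 by omega, one_nsmul] at key ⊢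
  exact key

/-- The coefficient of `Z X … X Y` vanishes. -/
theorem c_last_line_eq_zero (S : CoeffSystem V L k) (q : V) :
    S.c (S.seg (q + 1 • S.e) (k - 1)) {q, q + (k - 1) • S.e} = 0 := by
  by_contra hc
  have h3 := S.three_le
  set α := S.c (S.seg (q + 1 • S.e) (k - 1)) {q, q + (k - 1) • S.e} with hα
  -- Let `E_j(o)` be the decorated coefficient on the left. The two lines have coefficients `α` and
  -- `-α`, so subtracting `decorated_first` from `decorated_last` gives `h E_j(o) - h E_{j-1}(o + e)
  -- = 2 K α`, where the term `E_0` is absent.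
  have hstep : ∀ j : ℕ, 1 ≤ j → j ≤ k - 2 → ∀ o,
      S.c (S.seg (o + 1 • S.e) (k - 1)) {o, o + (k - 1) • S.e} = α →
      S.h * S.c (S.seg (o + 1 • S.e) (k - 2))
        ({o, o + (k - 1) • S.e} ∆ {o + j • S.e, o + j • S.e + S.f}) = 2 * j * S.K * α := by
    intro j hj
    induction j, hj using Nat.le_induction with
    | base =>
      intro hk o ho
      obtain ⟨m, hm⟩ := S.exists_at o
      have h1 := S.decorated_last o (j := 1) le_rfl (by omega)
      have h2 := S.decorated_first o (j := 1) le_rfl (by omega)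
      rw [if_neg (by omega), ho] at h1
      rw [if_pos rfl, (c_last_line_translate hm (ho ▸ hc)).2, ho] at h2
      rw [← h1, Nat.cast_one]
      linear_combination h2
    | succ j hj ih =>
      intro hk o ho
      obtain ⟨m, hm⟩ := S.exists_at o
      have h1 := S.decorated_last o (j := j + 1) (by omega) (by omega)
      have h2 := S.decorated_first o (j := j + 1) (by omega) (by omega)
      obtain ⟨h4, h5⟩ := c_last_line_translate hm (ho ▸ hc)
      have h6 := ih (by omega) (o + S.e) (h4.trans ho)
      rw [if_neg (by omega), ho] at h1
      rw [show o + S.e + j • S.e = o + (j + 1) • S.e by rw [add_assoc, ← succ_nsmul']] at h6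
      rw [if_neg (by omega), h5, ho, h6] at h2
      rw [← h1, Nat.cast_succ]
      linear_combination h2
  obtain ⟨m, hm⟩ := S.exists_at q
  have h1 := S.decorated_last q (j := k - 1) (by omega) (by omega)
  have h2 := S.decorated_first q (j := k - 1) (by omega) (by omega)
  obtain ⟨h4, h5⟩ := c_last_line_translate hm hc
  have h6 := hstep (k - 2) (by omega) le_rfl (q + S.e) h4
  have e1 : q + S.e + (k - 2) • S.e = q + (k - 1) • S.e := by
    rw [add_assoc, ← succ_nsmul', show k - 2 + 1 = k - 1 by omega]
  rw [e1] at h6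
  rw [if_pos rfl, ← hα] at h1
  rw [if_neg (by omega), h5, h6, ← hα] at h2
  -- At `j = k - 1` the term `E_j` is absent as well, which closes the recursion.
  have h7 : (2 * ((k - 2 : ℕ) : ℂ) + 2) * (S.K * α) = 0 := by linear_combination h1 - h2
  refine mul_ne_zero ?_ (mul_ne_zero S.K_ne hc) h7
  exact_mod_cast (by omega : 2 * (k - 2) + 2 ≠ 0)

/-- A string of width `k` has no `X` on its last plane. -/
theorem c_eq_zero_of_mem_last (hp : p ∈ a) (hpm : S.At (m + k - 1) p)
    (hq : q ∈ a ∪ b) (hqm : S.At m q) : S.c a b = 0 := by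
  by_contra hc
  obtain ⟨rfl, rfl⟩ := line_of_mem_last hc hp hpm hq hqm
  exact hc (S.c_last_line_eq_zero q)

/-- A string of width `k` has no `X` on its first plane. -/
theorem c_eq_zero_of_mem_first (hp : p ∈ a) (hpm : S.At m p)
    (hq : q ∈ a ∪ b) (hqm : S.At (m + k - 1) q) : S.c a b = 0 :=
  c_eq_zero_of_mem_last (S := S.reflect) (m := -(m + k - 1)) hp
    (by rw [at_reflect]; convert hpm using 1; ring) hq
    (by rw [at_reflect, neg_neg]; exact hqm)

/-! ### Shape of the remaining strings of width `k`. -/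

/-- The first plane of a string of width `k` is a single `Z`, and the string is tied to one of
width `k - 1`. -/
theorem contract_first (hc : S.c a b ≠ 0) (hq : q ∈ a ∪ b) (hqm : S.At (m + k - 1) q)
    (hp : p ∈ a ∪ b) (hpm : S.At m p) :
    (q ∉ a ∧ q ∈ b) ∧ (∀ y, S.At m y → y ∉ a ∧ (y ∈ b ↔ y = p)) ∧ p + S.e ∈ a ∧
      S.J * S.c (a ∆ {q}) (b ∆ {p, p + S.e}) = S.h * S.c a b := by
  have h3 := S.three_le
  have hfirst : ∀ y, S.At m y → y ∉ a := fun y hy hya =>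
    hc (c_eq_zero_of_mem_first hya hy hq hqm)
  have hqa : q ∉ a := fun hqa => hc (c_eq_zero_of_mem_last hqa hqm hp hpm)
  have hqb : q ∈ b := (Finset.mem_union.1 hq).resolve_left hqa
  have hpb : p ∈ b := (Finset.mem_union.1 hp).resolve_left (hfirst p hpm)
  have hmem : ∀ y, y ∈ a ∆ {q} ↔ y ∈ a ∨ y = q := by
    intro y
    rw [Finset.mem_symmDiff, Finset.mem_singleton]
    have : y = q → y ∉ a := fun h => h ▸ hqa
    tauto
  -- The target has an `X` at `q`, on the last plane. A field term survives only if it removes this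
  -- `X`, and an interaction only if it clears the first plane.
  have heq := S.eqn (a ∆ {q}) b
  rw [Finset.sum_eq_single_of_mem q hqb, symmDiff_symmDiff_cancel_right] at heq
  · have hterm : ∀ T, Odd (T ∩ (a ∆ {q})).card → S.G T * S.c (a ∆ {q}) (b ∆ T) ≠ 0 →
        T = {p, p + S.e} ∧ p + S.e ∈ a ∆ {q} ∧ ∀ y ∈ b, S.At m y → y = p := by
      intro T hT h0
      refine eq_bond_of_clear (left_ne_zero_of_mul h0) hT hpb hpm (fun y hy => ?_)
        fun y hy hym => ?_
      · rw [← not_or, ← Finset.mem_union]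
        exact fun hyT => right_ne_zero_of_mul h0
          (c_eq_zero_of_mem_last ((hmem q).2 (.inr rfl)) hqm hyT hy)
      · rcases (hmem y).1 hy with hya | rfl
        · exact (notMem_of_outside hc hp hq hpm hqm hym (by omega) (by omega) (by omega)).1 hya
        · have := hqm.unique hym (by omega) (by omega)
          omega
    obtain ⟨T, hT, h0⟩ := Finset.exists_ne_zero_of_sum_ne_zero
      (heq.trans_ne (mul_ne_zero S.h_ne hc))
    rw [Finset.mem_filter_univ] at hT
    obtain ⟨rfl, h1, h2⟩ := hterm T hT h0
    have hpe : p + S.e ∈ a :=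
      ((hmem _).1 h1).resolve_right (hpm.add_e.ne hqm (by omega) (by omega) (by omega))
    refine ⟨⟨hqa, hqb⟩, fun y hy => ⟨hfirst y hy, fun h => h2 y h hy, fun h => h ▸ hpb⟩, hpe, ?_⟩
    rw [Finset.sum_eq_single {p, p + S.e}, S.G_e] at heq
    · exact heq
    · intro T' hT' hne
      by_contra h0'
      exact hne (hterm T' (by simpa using hT') h0').1
    · intro h
      rw [Finset.mem_filter_univ] at h
      exact absurd hT h
  · intro s _ hsq
    refine c_eq_zero_of_mem_last (p := q) ?_ hqm (Finset.mem_union_right _ hpb) hpm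
    rw [Finset.mem_symmDiff, hmem, Finset.mem_singleton]
    exact .inl ⟨.inr rfl, hsq.symm⟩

/-- The second plane of a string of width `k` is a single `X`, and the string can be
translated. -/
theorem translate (hc : S.c a b ≠ 0) (hq : q ∈ a ∪ b) (hqm : S.At (m + k - 1) q)
    (hp : p ∈ a ∪ b) (hpm : S.At m p) :
    (∀ y, S.At (m + 1) y → (y ∈ a ↔ y = p + S.e) ∧ y ∉ b) ∧
      (p + S.e ∈ b ∆ {p, p + S.e} ∆ {q, q + S.e} ∧ q + S.e ∈ b ∆ {p, p + S.e} ∆ {q, q + S.e}) ∧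
      S.c (a ∆ {q} ∆ {p + S.e}) (b ∆ {p, p + S.e} ∆ {q, q + S.e}) = S.c a b := by
  have h3 := S.three_le
  obtain ⟨⟨hqa, hqb⟩, hfirst, hpea, heq₁⟩ := contract_first hc hq hqm hp hpm
  have hpe := hpm.add_e
  have hqe : S.At (m + k - 1 + 1) (q + S.e) := hqm.add_e
  have hout := fun {y l} => notMem_of_outside (y := y) (l := l) hc hp hq hpm hqm
  have hqeab := hout hqe (by omega) (by omega) (by omega)
  have hpq : p + S.e ≠ q := hpe.ne hqm (by omega) (by omega) (by omega)
  have hpq' : p + S.e ≠ q + S.e := hpe.ne hqe (by omega) (by omega) (by omega)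
  have hpq'' : p ≠ q + S.e := hpm.ne hqe (by omega) (by omega) (by omega)
  have hqq : q ≠ q + S.e := S.e_ne.symm
  set b₄ := b ∆ {p, p + S.e} ∆ {q, q + S.e} with hb₄
  have hmem : ∀ y, y ∈ a ∆ {q} ↔ y ∈ a ∨ y = q := by
    intro y
    rw [Finset.mem_symmDiff, Finset.mem_singleton]
    have : y = q → y ∉ a := fun h => h ▸ hqa
    tauto
  have hqe₄ : q + S.e ∈ b₄ := by
    simp [hb₄, Finset.mem_symmDiff, hqeab.2, hpq''.symm, hpq'.symm]
  -- The short string from `contract_first`, extended by the bond at `q`, fills the planes `m + 1,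
  -- …, m + k`. Its `X` on the first of them must be removed by the field, or else the last plane
  -- must be cleared by a bond; this ties the short string to the translated one.
  have heq := S.eqn (a ∆ {q}) b₄
  have hback : b₄ ∆ {q, q + S.e} = b ∆ {p, p + S.e} := by
    rw [hb₄, symmDiff_symmDiff_cancel_right]
  rw [Finset.sum_eq_single {q, q + S.e}, hback, S.G_e, heq₁] at heq
  · have heq' := mul_left_cancel₀ S.h_ne heq
    have hterm : ∀ s ∈ b₄, S.c (a ∆ {q} ∆ {s}) b₄ ≠ 0 →
        s = p + S.e ∧ ∀ y ∈ a, S.At (m + 1) y → y = p + S.e := by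
      intro s hs h0
      have key : ∀ y ∈ a, S.At (m + 1) y → y = s := by
        intro y hy hym
        by_contra hys
        refine h0 (c_eq_zero_of_mem_first (p := y) (q := q + S.e) (m := m + 1) ?_ hym
          (Finset.mem_union_right _ hqe₄) ?_)
        · rw [Finset.mem_symmDiff, hmem, Finset.mem_singleton]
          exact .inl ⟨.inl hy, hys⟩
        · convert hqe using 1; ring
      have hps := key _ hpea hpe
      exact ⟨hps.symm, hps ▸ key⟩
    obtain ⟨s, hs, h0⟩ := Finset.exists_ne_zero_of_sum_ne_zero (heq'.symm.trans_ne hc)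
    obtain ⟨rfl, huniq⟩ := hterm s hs h0
    rw [Finset.sum_eq_single_of_mem _ hs fun s' hs' hne => by
      by_contra h0'
      exact hne (hterm s' hs' h0').1] at heq'
    refine ⟨fun y hy => ⟨⟨fun h => huniq y h hy, fun h => h ▸ hpea⟩, fun hyb => ?_⟩,
      ⟨hs, hqe₄⟩, heq'.symm⟩
    -- The translated string again starts with a lone `Z`, now at `p + S.e`, which excludes any `Z`
    -- of `b` on this plane.
    have key := ((contract_first h0 (q := q + S.e) (m := m + 1) (p := p + S.e)
      (Finset.mem_union_right _ hqe₄) (by convert hqe using 1; ring)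
      (Finset.mem_union_right _ hs) hpe).2.1 y hy).2
    have e1 : y ≠ q := hy.ne hqm (by omega) (by omega) (by omega)
    have e2 : y ≠ q + S.e := hy.ne hqe (by omega) (by omega) (by omega)
    have e3 : y ≠ p := hy.ne hpm (by omega) (by omega) (by omega)
    by_cases hye : y = p + S.e
    · rw [← hye] at hs hpq hpq'
      simp [hb₄, Finset.mem_symmDiff, ← hye, hyb, hpq, hpq'] at hs
    · refine hye (key.1 ?_)
      simp [hb₄, Finset.mem_symmDiff, hyb, e1, e2, e3, hye]
  · intro T hT hne
    by_contra h0
    refine hne (eq_bond_of_clear_right (left_ne_zero_of_mul h0) (by simpa using hT) hqe₄ hqm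
      (fun y hy => ?_) fun y hy hym => ?_).1
    · rw [← not_or, ← Finset.mem_union]
      exact fun hyT => right_ne_zero_of_mul h0
        (c_eq_zero_of_mem_first ((hmem (p + S.e)).2 (.inl hpea)) hpe hyT
          (by convert hy using 1; ring))
    · rcases (hmem y).1 hy with hya | rfl
      · exact (hout hym (by omega) (by omega) (by omega)).1 hya
      · have := hqm.unique hym (by omega) (by omega)
        omega
  · intro h
    refine absurd ?_ h
    rw [Finset.mem_filter_univ, odd_card_pair_inter hqq, hmem, hmem]
    simp [hqeab.1, hqq.symm]

/-- A string of width `k` is `Z X … X Z` on a line. -/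
theorem line_of_width (hc : S.c a b ≠ 0) (hq : q ∈ a ∪ b) (hqm : S.At (m + k - 1) q)
    (hp : p ∈ a ∪ b) (hpm : S.At m p) :
    a = S.seg (p + 1 • S.e) (k - 2) ∧ b = {p, p + (k - 1) • S.e} := by
  have h3 := S.three_le
  let N : ℤ → Finset V → Finset V → V → Prop := fun m a b p =>
    S.c a b ≠ 0 ∧ (∃ q ∈ a ∪ b, S.At (m + k - 1) q) ∧ p ∈ a ∪ b ∧ S.At m p
  have hstep : ∀ m a b p q, S.c a b ≠ 0 → q ∈ a ∪ b → S.At (m + k - 1) q → p ∈ a ∪ b →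
      S.At m p →
      N (m + 1) (a ∆ {q} ∆ {p + S.e}) (b ∆ {p, p + S.e} ∆ {q, q + S.e}) (p + S.e) := by
    intro m a b p q hc hq hqm hp hpm
    obtain ⟨h1, ⟨h2, h2'⟩, h4⟩ := translate hc hq hqm hp hpm
    refine ⟨h4 ▸ hc, ⟨q + S.e, Finset.mem_union_right _ h2', ?_⟩,
      Finset.mem_union_right _ h2, hpm.add_e⟩
    convert hqm.add_e using 1; ring
  have hline := inner_line_of_translate (S := S) N (by
    rintro m a b p ⟨hc, ⟨q, hq, hqm⟩, hp, hpm⟩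
    refine ⟨(translate hc hq hqm hp hpm).1, _, _,
      hstep m a b p q hc hq hqm hp hpm, fun y n h1 h2 hy => ?_⟩
    have e1 : y ≠ q := hy.ne hqm (by omega) (by omega) (by omega)
    have e2 : y ≠ q + S.e := hy.ne hqm.add_e (by omega) (by omega) (by omega)
    have e3 : y ≠ p := hy.ne hpm (by omega) (by omega) (by omega)
    have e4 : y ≠ p + S.e := hy.ne hpm.add_e (by omega) (by omega) (by omega)
    simp [Finset.mem_symmDiff, e1, e2, e3, e4])
  have hbt := fun {s} => between (s := s) hc hp hq hpm hqm
  obtain ⟨-, hfirst, -, -⟩ := contract_first hc hq hqm hp hpm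
  have hinner : ∀ j : ℕ, 0 < j → j < k - 1 → ∀ y, S.At (m + j) y →
      (y ∈ a ↔ y = p + j • S.e) ∧ y ∉ b := by
    intro j h1 h2 y hy
    obtain ⟨i, rfl⟩ : ∃ i, j = i + 1 := ⟨j - 1, by omega⟩
    exact hline i m a b p ⟨hc, ⟨q, hq, hqm⟩, hp, hpm⟩ (by omega) y hy
  have hlast : ∀ y, S.At (m + (k - 1 : ℕ)) y →
      y ∉ a ∧ (y = q ↔ y = p + (k - 1) • S.e) ∧ (y ∈ b ↔ y = q) := by
    intro y hy
    have h0 : y ∉ a := fun h => hc (c_eq_zero_of_mem_last h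
      (by convert hy using 1; omega) hp hpm)
    have h1 := hline (k - 3) _ _ _ _ (hstep m a b p q hc hq hqm hp hpm) (by omega) y
      (by convert hy using 1; omega)
    rw [add_assoc, ← succ_nsmul', show k - 3 + 1 + 1 = k - 1 by omega] at h1
    have e2 : y ≠ q + S.e := hy.ne hqm.add_e (by omega) (by omega) (by omega)
    have e3 : y ≠ p := hy.ne hpm (by omega) (by omega) (by omega)
    have e4 : y ≠ p + S.e := hy.ne hpm.add_e (by omega) (by omega) (by omega)
    simp only [Finset.mem_symmDiff, Finset.mem_singleton, Finset.mem_insert, h0, e2, e3, e4] at h1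
    clear * - h0 h1
    tauto
  constructor
  · refine eq_of_planes (fun y hy => hbt (Finset.mem_union_left b hy))
      (hpm.seg_between (by omega)) fun j hj y hy => ?_
    rcases Nat.eq_zero_or_pos j with rfl | h0
    · have := (hfirst y (by simpa using hy)).1
      simp only [this, false_iff]
      intro hmem
      obtain ⟨i, hi, rfl⟩ := mem_seg.1 hmem
      have := hy.unique ((hpm.nsmul 1).nsmul i) (by omega) (by omega)
      omega
    · rw [At.mem_seg_iff (j := j - 1) (hpm.nsmul 1) (by convert hy using 1; omega) (by omega)
        (by omega), add_assoc, ← add_nsmul, show 1 + (j - 1) = j by omega]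
      rcases (show j < k - 1 ∨ j = k - 1 by omega) with h | rfl
      · rw [(hinner j h0 h y hy).1]
        exact ⟨fun h => ⟨by omega, h⟩, fun h => h.2⟩
      · simp only [(hlast y hy).1, false_iff]
        omega
  · refine eq_of_planes (fun y hy => hbt (Finset.mem_union_right a hy)) hpm.ends_between
      fun j hj y hy => ?_
    rw [hpm.mem_ends_iff hy hj]
    rcases Nat.eq_zero_or_pos j with rfl | h0
    · rw [(hfirst y (by simpa using hy)).2]
      have : 0 ≠ k - 1 := by omega
      simp [this]
    · rcases (show j < k - 1 ∨ j = k - 1 by omega) with h | rfl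
      · have h4 := (hinner j h0 h y hy).2
        have h5 : j ≠ k - 1 := by omega
        have h6 : j ≠ 0 := by omega
        simp [h4, h5, h6]
      · rw [(hlast y hy).2.2, (hlast y hy).2.1]
        have h6 : k - 1 ≠ 0 := by omega
        simp [h6]

/-- The coefficient of `Z X … X Z` is invariant under translation and tied to that of the shorter
string `Y X … X Y`. -/
theorem c_line_translate (hm : S.At m q)
    (hc : S.c (S.seg (q + 1 • S.e) (k - 2)) {q, q + (k - 1) • S.e} ≠ 0) :
    S.c (S.seg (q + S.e + 1 • S.e) (k - 2)) {q + S.e, q + S.e + (k - 1) • S.e} =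
      S.c (S.seg (q + 1 • S.e) (k - 2)) {q, q + (k - 1) • S.e} ∧
    S.J * S.c (S.seg (q + 1 • S.e) (k - 1)) {q + 1 • S.e, q + (k - 1) • S.e} =
      S.h * S.c (S.seg (q + 1 • S.e) (k - 2)) {q, q + (k - 1) • S.e} := by
  have h3 := S.three_le
  have hpm : S.At (m + k - 1) (q + (k - 1) • S.e) := by
    convert hm.nsmul (k - 1) using 1; omega
  have hp : q + (k - 1) • S.e ∈
      S.seg (q + 1 • S.e) (k - 2) ∪ {q, q + (k - 1) • S.e} := by simp
  have hq : q ∈ S.seg (q + 1 • S.e) (k - 2) ∪ {q, q + (k - 1) • S.e} := by simp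
  obtain ⟨-, ⟨h1, h2⟩, h4⟩ := translate hc hp hpm hq hm
  constructor
  · obtain ⟨h5, h6⟩ := line_of_width (h4 ▸ hc) (q := q + (k - 1) • S.e + S.e) (p := q + S.e)
      (m := m + 1) (Finset.mem_union_right _ h2) (by convert hpm.add_e using 1; ring)
      (Finset.mem_union_right _ h1) hm.add_e
    rwa [h5, h6] at h4
  · obtain ⟨-, -, -, h5⟩ := contract_first hc hp hpm hq hm
    have hseg : S.seg (q + 1 • S.e) (k - 2) ∆ {q + (k - 1) • S.e} =
        S.seg (q + 1 • S.e) (k - 1) := by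
      have := seg_succ_symmDiff (S := S) (q := q) (i := 1) (l := k - 2) (by omega)
      rw [show k - 2 + 1 = k - 1 by omega, show 1 + (k - 2) = k - 1 by omega] at this
      rw [← this, symmDiff_symmDiff_cancel_right]
    have hb : ({q, q + (k - 1) • S.e} : Finset V) ∆ {q, q + S.e} =
        {q + 1 • S.e, q + (k - 1) • S.e} := by
      have e1 : q ≠ q + (k - 1) • S.e := hm.ne hpm (by omega) (by omega) (by omega)
      have e2 : q ≠ q + S.e := S.e_ne.symm
      have e3 : q + S.e ≠ q + (k - 1) • S.e := hm.add_e.ne hpm (by omega) (by omega) (by omega)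
      rw [one_nsmul]
      ext y
      simp only [Finset.mem_symmDiff, Finset.mem_insert, Finset.mem_singleton]
      clear * - e1 e2 e3
      grind
    rwa [hseg, hb] at h5

/-! ### Exclusion of `Z X … X Z`. -/

/-- A string of width `k - 1` with an `X` on both end planes has a single `Z` at either end. -/
theorem ends_of_mem_both (hc : S.c a b ≠ 0) (hp : p ∈ a) (hpm : S.At m p) (hq : q ∈ a)
    (hqm : S.At (m + k - 2) q) : b = {p, p + (k - 2) • S.e} := by
  have h3 := S.three_le
  have hqe : S.At (m + k - 1) (q + S.e) := by convert hqm.add_e using 1; ring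
  have hempty : ∀ y, S.At (m + k - 1) y → y ∉ a ∧ y ∉ b := by
    intro y hy
    rw [← not_or, ← Finset.mem_union]
    exact fun h => hc (c_eq_zero_of_mem_first hp hpm h hy)
  have hqq : q ≠ q + S.e := S.e_ne.symm
  have hqeb : q + S.e ∈ b ∆ {q, q + S.e} := by
    simp [Finset.mem_symmDiff, (hempty _ hqe).2]
  -- Lengthen by the bond at `q` to width `k`. As long as the `X` at `p` stays, the last plane must
  -- be cleared, so the only surviving field term removes that `X`; the result is a `Z X … X Z`
  -- line.
  have heq := S.eqn a (b ∆ {q, q + S.e})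
  rw [Finset.sum_eq_single {q, q + S.e}, symmDiff_symmDiff_cancel_right, S.G_e] at heq
  · obtain ⟨s, hs, h0⟩ := Finset.exists_ne_zero_of_sum_ne_zero
      (right_ne_zero_of_mul (heq.symm.trans_ne (mul_ne_zero S.J_ne hc)))
    have hps : p = s := by
      by_contra hps
      refine h0 (c_eq_zero_of_mem_first (p := p) ?_ hpm (Finset.mem_union_right _ hqeb) hqe)
      simp [Finset.mem_symmDiff, hp, hps]
    rw [← hps] at hs h0
    obtain ⟨h1, h2⟩ := line_of_width h0 (Finset.mem_union_right _ hqeb) hqe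
      (Finset.mem_union_right _ hs) hpm
    have e1 : q + S.e = p + (k - 1) • S.e := by
      rw [h2, Finset.mem_insert, Finset.mem_singleton] at hqeb
      exact hqeb.resolve_left (hqe.ne hpm (by omega) (by omega) (by omega))
    have e2 : q = p + (k - 2) • S.e := by
      rw [show k - 1 = k - 2 + 1 by omega, succ_nsmul, ← add_assoc] at e1
      exact add_right_cancel e1
    have e3 : p ≠ q := hpm.ne hqm (by omega) (by omega) (by omega)
    have e4 : p ≠ q + S.e := hpm.ne hqe (by omega) (by omega) (by omega)
    rw [← e1] at h2
    rw [← e2, ← symmDiff_symmDiff_cancel_right {q, q + S.e} b, h2]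
    ext y
    simp only [Finset.mem_symmDiff, Finset.mem_insert, Finset.mem_singleton]
    clear * - e3 e4 hqq
    grind
  · intro T hT hne
    by_contra h0
    refine hne (eq_bond_of_clear_right (left_ne_zero_of_mul h0) (by simpa using hT) hqeb hqm
      (fun y hy => ?_) fun y hy hym => ?_).1
    · rw [← not_or, ← Finset.mem_union]
      exact fun hyT => right_ne_zero_of_mul h0
        (c_eq_zero_of_mem_first hp hpm hyT (by convert hy using 1; ring))
    · refine hc (c_eq_zero_of_far (Finset.mem_union_left b hp) (Finset.mem_union_left b hy) hpm ?_)
      convert hym using 1; ring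
  · intro h
    refine absurd ?_ h
    rw [Finset.mem_filter_univ, odd_card_pair_inter hqq]
    simp [hq, (hempty _ hqe).1]

/-- The equation at `Z X … X Z` decorated by a bond in the direction `f`. -/
theorem decorated_line (S : CoeffSystem V L k) (q : V) {j : ℕ} (h1 : 1 ≤ j) (hj : j ≤ k - 2) :
    S.K * S.c (S.seg (q + 1 • S.e) (k - 2)) {q, q + (k - 1) • S.e} +
      S.J * S.c (S.seg (q + 1 • S.e) (k - 2))
        ({q + 1 • S.e, q + (k - 1) • S.e} ∆ {q + j • S.e, q + j • S.e + S.f}) +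
      S.J * S.c (S.seg (q + 1 • S.e) (k - 2))
        ({q, q + (k - 2) • S.e} ∆ {q + j • S.e, q + j • S.e + S.f}) = 0 := by
  have h3 := S.three_le
  obtain ⟨m, hm⟩ := S.exists_at q
  have hpm : S.At (m + k - 1) (q + (k - 1) • S.e) := by
    convert hm.nsmul (k - 1) using 1; omega
  have htm : S.At (m + k - 2) (q + (k - 2) • S.e) := by
    convert hm.nsmul (k - 2) using 1; omega
  have hta : q + (k - 2) • S.e ∈ S.seg (q + 1 • S.e) (k - 2) := by
    rw [nsmul_mem_seg (by omega) (by omega)]; omega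
  have hpa : q + (k - 1) • S.e ∉ S.seg (q + 1 • S.e) (k - 2) := by
    rw [nsmul_mem_seg (by omega) (by omega)]; omega
  have hea : q + 1 • S.e ∈ S.seg (q + 1 • S.e) (k - 2) := by
    rw [nsmul_mem_seg (by omega) (by omega)]; omega
  have hra : q + j • S.e ∈ S.seg (q + 1 • S.e) (k - 2) := by
    rw [nsmul_mem_seg (by omega) (by omega)]; omega
  have hfa : q + j • S.e + S.f ∉ S.seg (q + 1 • S.e) (k - 2) :=
    add_f_notMem_seg (by omega) (by omega)
  have hqa : q ∉ S.seg (q + 1 • S.e) (k - 2) := self_notMem_seg (by omega) (by omega)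
  have hqf : q ≠ q + j • S.e + S.f := self_ne_add_f (by omega)
  have hqr : q ≠ q + j • S.e := self_ne_nsmul (by omega) (by omega)
  have hqp : q ≠ q + (k - 1) • S.e := self_ne_nsmul (by omega) (by omega)
  have hqt : q ≠ q + (k - 2) • S.e := self_ne_nsmul (by omega) (by omega)
  have hq1 : q ≠ q + 1 • S.e := self_ne_nsmul (by omega) (by omega)
  have hp1 : q + (k - 1) • S.e ≠ q + 1 • S.e := by
    rw [Ne, nsmul_inj (by omega) (by omega)]
    omega
  have hpr : q + (k - 1) • S.e ≠ q + j • S.e := by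
    rw [Ne, nsmul_inj (by omega) (by omega)]
    omega
  have hpt : q + (k - 1) • S.e ≠ q + (k - 2) • S.e := by
    rw [Ne, nsmul_inj (by omega) (by omega)]
    omega
  have hpf : q + (k - 1) • S.e ≠ q + j • S.e + S.f := nsmul_ne_add_f (by omega) (by omega)
  have hte : q + (k - 1) • S.e = q + (k - 2) • S.e + S.e := by
    rw [add_assoc, ← succ_nsmul, show k - 2 + 1 = k - 1 by omega]
  have hout : ∀ y n, S.At n y → m - 1 ≤ n → n ≤ m + k → (n ≤ m ∨ m + k - 1 ≤ n) →
      y ∉ S.seg (q + 1 • S.e) (k - 2) := by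
    intro y n hy h1 h2 h4 hya
    obtain ⟨i, hi, rfl⟩ := mem_seg.1 hya
    have := hy.unique ((hm.nsmul 1).nsmul i) (by omega) (by omega)
    omega
  generalize hag : S.seg (q + 1 • S.e) (k - 2) = a at *
  generalize hpg : q + (k - 1) • S.e = p at *
  generalize htg : q + (k - 2) • S.e = t at *
  generalize hrg : q + j • S.e = r at *
  simp only [one_nsmul] at hq1 hp1 hea ⊢
  set b : Finset V := {q, p} ∆ {r, r + S.f} with hb
  have hmem : ∀ y, y ∈ b ↔ ¬ (y = q ∨ y = p ↔ y = r ∨ y = r + S.f) := by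
    intro y
    simp only [hb, Finset.mem_symmDiff, Finset.mem_insert, Finset.mem_singleton]
    clear * -
    grind
  have hqb : q ∈ b := by simp [hmem, hqr, hqf]
  have hpb : p ∈ b := by simp [hmem, hpr, hpf]
  have hfb : r + S.f ∈ b := by simp [hmem, hqf.symm, hpf.symm]
  -- The field keeps the set `b`, and a string of width `k` allows no `Z` off the line.
  have hrhs : ∑ s ∈ b, S.c (a ∆ {s}) b = 0 := by
    refine Finset.sum_eq_zero fun s hs => ?_
    by_contra hc
    have := (line_of_width hc (Finset.mem_union_right _ hpb) hpm
      (Finset.mem_union_right _ hqb) hm).2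
    rw [this, hpg, Finset.mem_insert, Finset.mem_singleton] at hfb
    exact hfb.elim hqf.symm hpf.symm
  have hb1 : b ∆ {q, q + S.e} = {q + S.e, p} ∆ {r, r + S.f} := by
    rw [hb, symmDiff_right_comm]
    congr 1
    ext y
    simp only [Finset.mem_symmDiff, Finset.mem_insert, Finset.mem_singleton]
    clear * - hqp hq1 hp1
    grind
  have hb2 : b ∆ {r, r + S.f} = {q, p} := by rw [hb, symmDiff_symmDiff_cancel_right]
  have hb3 : b ∆ {t, p} = {q, t} ∆ {r, r + S.f} := by
    rw [hb, symmDiff_right_comm]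
    congr 1
    ext y
    simp only [Finset.mem_symmDiff, Finset.mem_insert, Finset.mem_singleton]
    clear * - hqp hqt hpt
    grind
  have hn12 : ({r, r + S.f} : Finset V) ≠ {q, q + S.e} := by
    intro h
    have : q ∈ ({r, r + S.f} : Finset V) := h ▸ Finset.mem_insert_self _ _
    rw [Finset.mem_insert, Finset.mem_singleton] at this
    exact this.elim hqr hqf
  have hn23 : ({r, r + S.f} : Finset V) ≠ {t, p} := by
    intro h
    have : p ∈ ({r, r + S.f} : Finset V) := by simp [h]
    rw [Finset.mem_insert, Finset.mem_singleton] at this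
    exact this.elim hpr hpf
  have hn13 : ({q, q + S.e} : Finset V) ≠ {t, p} := by
    intro h
    have : q ∈ ({t, p} : Finset V) := h ▸ Finset.mem_insert_self _ _
    rw [Finset.mem_insert, Finset.mem_singleton] at this
    exact this.elim hqt hqp
  have hGt : S.G {t, p} = S.J := by rw [hte, S.G_e]
  have heq := S.eqn a b
  rw [hrhs, mul_zero, ← Finset.sum_subset
    (s₁ := {({r, r + S.f} : Finset V), ({q, q + S.e} : Finset V), ({t, p} : Finset V)}),
    Finset.sum_insert (by simp [hn12, hn23]), Finset.sum_pair hn13, S.G_e, S.G_f, hGt,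
    hb1, hb2, hb3, ← add_assoc] at heq
  · exact heq
  · intro T hT
    rw [Finset.mem_filter_univ]
    rw [Finset.mem_insert, Finset.mem_insert, Finset.mem_singleton] at hT
    rcases hT with rfl | rfl | rfl
    · rw [odd_card_pair_inter (fun h => S.f_ne (by simpa using h))]
      simp [hra, hfa]
    · rw [odd_card_pair_inter hq1]
      simp [hqa, hea]
    · rw [odd_card_pair_inter hpt.symm]
      simp [hpa, hta]
  · intro T hT hne
    rw [Finset.mem_insert, Finset.mem_insert, Finset.mem_singleton, not_or, not_or] at hne
    obtain ⟨hT2, hT1, hT3⟩ := hne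
    rw [Finset.mem_filter_univ] at hT
    by_contra h0
    have hG := left_ne_zero_of_mul h0
    have hc := right_ne_zero_of_mul h0
    -- The ends are at least two planes apart, so no interaction touches both. Each remaining one
    -- clears an end by a bond or leaves the width `k` and removes the decoration.
    have hboth : ¬ (q ∈ T ∧ p ∈ T) := by
      rintro ⟨hqT, hpT⟩
      rcases S.G_local T hG with h | ⟨s, rfl⟩
      · have : S.At m p := by
          unfold At
          rw [← h q hqT p hpT]
          exact hm
        have := this.unique hpm (by omega) (by omega)
        omega
      · rw [Finset.mem_insert, Finset.mem_singleton] at hqT hpT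
        rcases hqT with rfl | rfl <;> rcases hpT with h | h
        · exact hqp h.symm
        · exact hp1 h
        · have := (h ▸ hpm).unique hm.of_add_e (by omega) (by omega)
          omega
        · exact hqp h.symm
    by_cases hqT : q ∈ T
    · have hpT : p ∈ b ∆ T := by
        rw [Finset.mem_symmDiff]
        exact .inl ⟨hpb, fun h => hboth ⟨hqT, h⟩⟩
      refine hT1 (eq_bond_of_clear hG hT hqb hm (fun y hy =>
        ⟨hout y m hy (by omega) (by omega) (by omega), fun hyT => ?_⟩)
        fun y hy hym => hout y _ hym (by omega) (by omega) (by omega) hy).1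
      have hl := (line_of_width hc (Finset.mem_union_right _ hpT) hpm
        (Finset.mem_union_right _ hyT) hy).2
      rw [hl, Finset.mem_insert, Finset.mem_singleton, ← hpg] at hpT
      rcases hpT with hpT | hpT
      · rw [hpg] at hpT
        exact hpm.ne hy (by omega) (by omega) (by omega) hpT
      · rw [← add_right_cancel hpT, Finset.mem_symmDiff] at hyT
        exact hyT.elim (fun h => h.2 hqT) (fun h => h.2 hqb)
    · have hqT' : q ∈ b ∆ T := by
        rw [Finset.mem_symmDiff]
        exact .inl ⟨hqb, hqT⟩
      by_cases hpT : p ∈ T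
      · rw [hte] at hT3 hpb
        refine hT3 (eq_bond_of_clear_right hG hT hpb htm (fun y hy =>
          ⟨hout y _ hy (by omega) (by omega) (by omega), fun hyT => ?_⟩)
          fun y hy hym => hout y _ hym (by omega) (by omega) (by omega) hy).1
        have hl := (line_of_width hc (Finset.mem_union_right _ hyT)
          (by convert hy using 1; ring) (Finset.mem_union_right _ hqT') hm).2
        have : p ∈ b ∆ T := by simp [hl, hpg]
        rw [Finset.mem_symmDiff, hte] at this
        rw [hte] at hpT
        exact this.elim (fun h => h.2 hpT) (fun h => h.2 hpb)
      · have hpT' : p ∈ b ∆ T := by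
          rw [Finset.mem_symmDiff]
          exact .inl ⟨hpb, hpT⟩
        have hl := (line_of_width hc (Finset.mem_union_right _ hpT') hpm
          (Finset.mem_union_right _ hqT') hm).2
        rw [hpg] at hl
        have hTb : T = b ∆ (b ∆ T) := by rw [symmDiff_symmDiff_cancel_left]
        rw [hl, hb, symmDiff_comm, symmDiff_symmDiff_cancel_left] at hTb
        exact hT2 hTb

/-- The equation at `Y X … X Y` of width `k - 1` decorated by a bond in the direction `f`. -/
theorem decorated_short (S : CoeffSystem V L k) (q : V) {j : ℕ} (h1 : 1 ≤ j) (hj : j ≤ k - 1) :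
    S.K * S.c (S.seg (q + 1 • S.e) (k - 1)) {q + 1 • S.e, q + (k - 1) • S.e} =
      S.h * ((if j = k - 1 then 0 else S.c (S.seg (q + 1 • S.e) (k - 2))
        ({q + 1 • S.e, q + (k - 1) • S.e} ∆ {q + j • S.e, q + j • S.e + S.f})) +
      (if j = 1 then 0 else S.c (S.seg (q + S.e + 1 • S.e) (k - 2))
        ({q + S.e, q + S.e + (k - 2) • S.e} ∆ {q + j • S.e, q + j • S.e + S.f}))) := by
  have h3 := S.three_le
  obtain ⟨m, hm⟩ := S.exists_at q
  have hpm : S.At (m + 1 + k - 2) (q + (k - 1) • S.e) := by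
    convert hm.nsmul (k - 1) using 1; omega
  have hem : S.At (m + 1) (q + 1 • S.e) := by simpa using hm.add_e
  have hpa : q + (k - 1) • S.e ∈ S.seg (q + 1 • S.e) (k - 1) := by
    rw [nsmul_mem_seg (by omega) (by omega)]; omega
  have hea : q + 1 • S.e ∈ S.seg (q + 1 • S.e) (k - 1) := by
    rw [nsmul_mem_seg (by omega) (by omega)]; omega
  have hra : q + j • S.e ∈ S.seg (q + 1 • S.e) (k - 1) := by
    rw [nsmul_mem_seg (by omega) (by omega)]; omega
  have hfa : q + j • S.e + S.f ∉ S.seg (q + 1 • S.e) (k - 1) :=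
    add_f_notMem_seg (by omega) (by omega)
  have hp1 : q + (k - 1) • S.e ≠ q + 1 • S.e := by
    rw [Ne, nsmul_inj (by omega) (by omega)]
    omega
  have hpr : q + (k - 1) • S.e = q + j • S.e ↔ j = k - 1 := by
    rw [nsmul_inj (by omega) (by omega), eq_comm]
  have her : q + 1 • S.e = q + j • S.e ↔ j = 1 := by
    rw [nsmul_inj (by omega) (by omega), eq_comm]
  have hpf : q + (k - 1) • S.e ≠ q + j • S.e + S.f := nsmul_ne_add_f (by omega) (by omega)
  have hef : q + 1 • S.e ≠ q + j • S.e + S.f := nsmul_ne_add_f (by omega) (by omega)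
  have hseg : S.seg (q + 1 • S.e) (k - 1) ∆ {q + (k - 1) • S.e} = S.seg (q + 1 • S.e) (k - 2) := by
    have := seg_succ_symmDiff (S := S) (q := q) (i := 1) (l := k - 2) (by omega)
    rwa [show k - 2 + 1 = k - 1 by omega, show 1 + (k - 2) = k - 1 by omega] at this
  have hseg' : S.seg (q + 1 • S.e) (k - 1) ∆ {q + 1 • S.e} =
      S.seg (q + S.e + 1 • S.e) (k - 2) := by
    have h4 : S.seg (q + 1 • S.e) (k - 1) =
        insert (q + 1 • S.e) (S.seg (q + S.e + 1 • S.e) (k - 2)) := by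
      ext y
      rw [Finset.mem_insert, mem_seg, mem_seg]
      constructor
      · rintro ⟨i, hi, rfl⟩
        rcases i with _ | i
        · simp
        · exact .inr ⟨i, by omega, by rw [one_nsmul, succ_nsmul]; abel⟩
      · rintro (rfl | ⟨i, hi, rfl⟩)
        · exact ⟨0, by omega, by simp⟩
        · exact ⟨i + 1, by omega, by rw [one_nsmul, succ_nsmul]; abel⟩
    have h5 : q + 1 • S.e ∉ S.seg (q + S.e + 1 • S.e) (k - 2) := by
      rw [one_nsmul, ← one_nsmul (S.e)]
      exact self_notMem_seg (by omega) (by omega)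
    rw [h4]
    ext y
    rw [Finset.mem_symmDiff, Finset.mem_insert, Finset.mem_singleton]
    have : y = q + 1 • S.e → y ∉ S.seg (q + S.e + 1 • S.e) (k - 2) := fun h => h ▸ h5
    clear * - this
    tauto
  have hpe : q + S.e + (k - 2) • S.e = q + (k - 1) • S.e := by
    rw [add_assoc, ← succ_nsmul', show k - 2 + 1 = k - 1 by omega]
  have hpe' : q + 1 • S.e + (k - 2) • S.e = q + (k - 1) • S.e := by rw [one_nsmul, hpe]
  rw [hpe, ← hseg, ← hseg', show q + S.e = q + 1 • S.e by rw [one_nsmul]]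
  generalize S.seg (q + 1 • S.e) (k - 1) = a at *
  generalize q + (k - 1) • S.e = p at *
  generalize q + j • S.e = r at *
  generalize q + 1 • S.e = o at *
  set b : Finset V := {o, p} ∆ {r, r + S.f} with hb
  have hmem : ∀ y, y ∈ b ↔ ¬ (y = o ∨ y = p ↔ y = r ∨ y = r + S.f) := by
    intro y
    simp only [hb, Finset.mem_symmDiff, Finset.mem_insert, Finset.mem_singleton]
    clear * -
    grind
  have hob : o ∈ b ↔ j ≠ 1 := by simp [hmem, her, hef]
  have hpb : p ∈ b ↔ j ≠ k - 1 := by simp [hmem, hpr, hpf]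
  have hfb : r + S.f ∈ b := by simp [hmem, hef.symm, hpf.symm]
  -- With an `X` left on both end planes, `ends_of_mem_both` forbids the decoration. A flip at an
  -- end needs a `Z` there, which the bond cancels at `p` for `j = k - 1` and at `o` for `j = 1`.
  have hrhs : ∀ s ∈ b, s ≠ o → s ≠ p → S.c (a ∆ {s}) b = 0 := by
    intro s hs hso hsp
    by_contra hc
    have := ends_of_mem_both hc (p := o) (q := p) (by simp [Finset.mem_symmDiff, hea, hso.symm])
      hem (by simp [Finset.mem_symmDiff, hpa, hsp.symm]) hpm
    rw [this, hpe', Finset.mem_insert, Finset.mem_singleton] at hfb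
    exact hfb.elim hef.symm hpf.symm
  have hb2 : b ∆ {r, r + S.f} = {o, p} := by rw [hb, symmDiff_symmDiff_cancel_right]
  have heq := S.eqn a b
  rw [Finset.sum_eq_single {r, r + S.f}, S.G_f, hb2] at heq
  · rw [heq]
    congr 1
    have hs : ∑ s ∈ b, S.c (a ∆ {s}) b =
        ∑ s ∈ {p, o}, if s ∈ b then S.c (a ∆ {s}) b else 0 := by
      rw [Finset.sum_ite_mem, Finset.inter_comm]
      refine (Finset.sum_subset Finset.inter_subset_left fun s hs hs' => hrhs s hs ?_ ?_).symm <;>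
      · rintro rfl
        simp [hs] at hs'
    rw [hs, Finset.sum_pair hp1]
    simp only [hob, hpb, ite_not, ne_eq]
  · intro T hT hne
    by_contra h0
    have hl := ends_of_mem_both (right_ne_zero_of_mul h0) hea hem hpa hpm
    have hTb : T = b ∆ (b ∆ T) := by rw [symmDiff_symmDiff_cancel_left]
    rw [hl, hpe', hb, symmDiff_comm, symmDiff_symmDiff_cancel_left] at hTb
    exact hne hTb
  · intro h
    refine absurd ?_ h
    rw [Finset.mem_filter_univ, odd_card_pair_inter (fun h => S.f_ne (by simpa using h))]
    simp [hra, hfa]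

/-- The coefficient of `Z X … X Z` vanishes. -/
theorem c_line_eq_zero (S : CoeffSystem V L k) (q : V) :
    S.c (S.seg (q + 1 • S.e) (k - 2)) {q, q + (k - 1) • S.e} = 0 := by
  by_contra hc
  have h3 := S.three_le
  set β := S.c (S.seg (q + 1 • S.e) (k - 2)) {q, q + (k - 1) • S.e} with hβ
  -- Let `A_j`, `B_j` be the decorated short strings with their outer `Z` on the right and on the
  -- left. `decorated_line` gives `J A_j(o) + J B_j(o) = -K β`; `decorated_short` with
  -- `c_line_translate` gives `J A_j(o) + J B_{j-1}(o + e) = K β`. Each step therefore adds `-2 K β`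
  -- to `J B_j`, starting without `B_0`.
  have hstep : ∀ j : ℕ, 1 ≤ j → j ≤ k - 2 → ∀ o,
      S.c (S.seg (o + 1 • S.e) (k - 2)) {o, o + (k - 1) • S.e} = β →
      S.J * S.c (S.seg (o + 1 • S.e) (k - 2))
        ({o, o + (k - 2) • S.e} ∆ {o + j • S.e, o + j • S.e + S.f}) = -(2 * j * S.K * β) := by
    intro j hj
    induction j, hj using Nat.le_induction with
    | base =>
      intro hk o ho
      obtain ⟨m, hm⟩ := S.exists_at o
      have h1 := S.decorated_line o (j := 1) le_rfl (by omega)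
      have h2 := S.decorated_short o (j := 1) le_rfl (by omega)
      have h4 := (c_line_translate hm (ho ▸ hc)).2
      rw [if_neg (by omega), if_pos rfl, add_zero] at h2
      rw [ho] at h1 h4
      rw [Nat.cast_one]
      refine mul_left_cancel₀ S.h_ne ?_
      linear_combination S.h * h1 + S.J * h2 - S.K * h4
    | succ j hj ih =>
      intro hk o ho
      obtain ⟨m, hm⟩ := S.exists_at o
      have h1 := S.decorated_line o (j := j + 1) (by omega) (by omega)
      have h2 := S.decorated_short o (j := j + 1) (by omega) (by omega)
      obtain ⟨h5, h4⟩ := c_line_translate hm (ho ▸ hc)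
      have h6 := ih (by omega) (o + S.e) (h5.trans ho)
      rw [show o + S.e + j • S.e = o + (j + 1) • S.e by rw [add_assoc, ← succ_nsmul']] at h6
      rw [if_neg (by omega), if_neg (by omega)] at h2
      rw [ho] at h1 h4
      rw [Nat.cast_succ]
      refine mul_left_cancel₀ S.h_ne ?_
      linear_combination S.h * h1 + S.J * h2 - S.K * h4 + S.h * h6
  obtain ⟨m, hm⟩ := S.exists_at q
  have h2 := S.decorated_short q (j := k - 1) (by omega) le_rfl
  obtain ⟨h5, h4⟩ := c_line_translate hm hc
  have h6 := hstep (k - 2) (by omega) le_rfl (q + S.e) h5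
  have e1 : q + S.e + (k - 2) • S.e = q + (k - 1) • S.e := by
    rw [add_assoc, ← succ_nsmul', show k - 2 + 1 = k - 1 by omega]
  rw [e1] at h6
  rw [if_pos rfl, if_neg (by omega), zero_add, e1] at h2
  rw [← hβ] at h4
  -- At `j = k - 1` there is no `A_j`, so `K β = J B_{k-2}(q + e) = -2 (k - 2) K β`.
  have h7 : S.h * ((2 * ((k - 2 : ℕ) : ℂ) + 1) * (S.K * β)) = 0 := by
    linear_combination S.J * h2 - S.K * h4 + S.h * h6
  refine mul_ne_zero S.h_ne (mul_ne_zero ?_ (mul_ne_zero S.K_ne hc)) h7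
  exact_mod_cast (by omega : 2 * (k - 2) + 1 ≠ 0)

/-- There is no string of width `k`. -/
theorem c_eq_zero_of_width (hq : q ∈ a ∪ b) (hqm : S.At (m + k - 1) q) (hp : p ∈ a ∪ b)
    (hpm : S.At m p) : S.c a b = 0 := by
  by_contra hc
  obtain ⟨rfl, rfl⟩ := line_of_width hc hq hqm hp hpm
  exact hc (S.c_line_eq_zero p)

end CoeffSystem

/-! ### From commuting operators to linear equations for coefficients. -/

/-- The single-site operator `X ^ α Z ^ β`. -/
def xzSite (α β : Bool) : Matrix (Fin 2) (Fin 2) ℂ :=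
  (if α then !![0, 1; 1, 0] else 1) * (if β then !![1, 0; 0, -1] else 1)

theorem xzSite_mul (α β α' β' : Bool) :
    xzSite α β * xzSite α' β' =
      (if β && α' then -1 else 1 : ℂ) • xzSite (α ^^ α') (β ^^ β') := by
  cases α <;> cases β <;> cases α' <;> cases β' <;> ext i j <;> fin_cases i <;> fin_cases j <;>
    simp [xzSite, Matrix.mul_apply]

theorem trace_transpose_xzSite_mul (α β α' β' : Bool) :
    ((xzSite α β).transpose * xzSite α' β').trace = if α = α' ∧ β = β' then 2 else 0 := by
  cases α <;> cases β <;> cases α' <;> cases β' <;>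
    simp [xzSite, Matrix.trace, Matrix.mul_apply, Fin.sum_univ_two] <;> norm_num

variable {V : Type*} [Fintype V]

/-- The tensor product over all sites of `2 × 2` matrices. -/
def siteTensor (M : V → Matrix (Fin 2) (Fin 2) ℂ) : Matrix (V → Fin 2) (V → Fin 2) ℂ :=
  Matrix.of fun s t => ∏ p, M p (s p) (t p)

theorem siteTensor_smul (z : V → ℂ) (M : V → Matrix (Fin 2) (Fin 2) ℂ) :
    (siteTensor fun p => z p • M p) = (∏ p, z p) • siteTensor M := by
  ext s t
  simp [siteTensor, Finset.prod_mul_distrib]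

variable [DecidableEq V]

theorem siteTensor_mul (M N : V → Matrix (Fin 2) (Fin 2) ℂ) :
    siteTensor M * siteTensor N = siteTensor fun p => M p * N p := by
  ext s t
  simp only [siteTensor, Matrix.mul_apply, Matrix.of_apply, Finset.prod_univ_sum,
    Fintype.piFinset_univ, Finset.prod_mul_distrib]

theorem trace_siteTensor (M : V → Matrix (Fin 2) (Fin 2) ℂ) :
    (siteTensor M).trace = ∏ p, (M p).trace := by
  simp only [siteTensor, Matrix.trace, Matrix.diag_apply, Matrix.of_apply, Finset.prod_univ_sum,
    Fintype.piFinset_univ]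

/-- The operator `∏_{p ∈ a} X_p ∏_{p ∈ b} Z_p`. -/
def xzProduct (a b : Finset V) : Matrix (V → Fin 2) (V → Fin 2) ℂ :=
  siteTensor fun p => xzSite (p ∈ a) (p ∈ b)

theorem xzProduct_mul (a b a' b' : Finset V) :
    xzProduct a b * xzProduct a' b' =
      (-1 : ℂ) ^ (b ∩ a').card • xzProduct (a ∆ a') (b ∆ b') := by
  have h1 : ∏ p, (if decide (p ∈ b) && decide (p ∈ a') then -1 else 1 : ℂ) =
      (-1) ^ (b ∩ a').card := by
    rw [← Finset.prod_const, ← Finset.prod_filter_mul_prod_filter_not Finset.univ (· ∈ b ∩ a')]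
    rw [Finset.prod_congr (g := fun _ => (-1 : ℂ)) (s₂ := b ∩ a') (by ext; simp) (by simp_all),
      Finset.prod_eq_one (s := Finset.univ.filter (¬ · ∈ b ∩ a')) (by simp_all), mul_one]
  rw [xzProduct, xzProduct, siteTensor_mul, xzProduct, ← h1, ← siteTensor_smul]
  congr 1
  ext1 p
  rw [xzSite_mul]
  congr 2 <;>
  · rw [Bool.eq_iff_iff]
    simp [Finset.mem_symmDiff]
    tauto

/-- The strings are orthogonal for the form `tr(Mᵀ N)`, which factorises over sites. -/
theorem eq_zero_of_sum_xzProduct_eq_zero {f : Finset V → Finset V → ℂ}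
    (h : ∑ a, ∑ b, f a b • xzProduct a b = 0) (a b : Finset V) : f a b = 0 := by
  have key : ∀ a' b' : Finset V,
      ((siteTensor fun p => (xzSite (p ∈ a) (p ∈ b)).transpose) * xzProduct a' b').trace =
        if a = a' then if b = b' then 2 ^ Fintype.card V else 0 else 0 := by
    intro a' b'
    rw [xzProduct, siteTensor_mul, trace_siteTensor]
    simp only [trace_transpose_xzSite_mul]
    split_ifs with h1 h2
    · simp [h1, h2, Finset.prod_const]
    · obtain ⟨p, hp⟩ : ∃ p, ¬ (p ∈ b ↔ p ∈ b') := by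
        by_contra! h
        exact h2 (Finset.ext h)
      refine Finset.prod_eq_zero (Finset.mem_univ p) (if_neg ?_)
      simp [decide_eq_decide, hp]
    · obtain ⟨p, hp⟩ : ∃ p, ¬ (p ∈ a ↔ p ∈ a') := by
        by_contra! h
        exact h1 (Finset.ext h)
      refine Finset.prod_eq_zero (Finset.mem_univ p) (if_neg ?_)
      simp [decide_eq_decide, hp]
  have := congr_arg (fun M =>
    ((siteTensor fun p => (xzSite (p ∈ a) (p ∈ b)).transpose) * M).trace) h
  simpa [Finset.mul_sum, Matrix.trace_sum, key] using this

/-- The equations for the coefficients of an operator commuting with a Hamiltonian of interactions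
`G T ∏_{p ∈ T} Z_p` in a transverse field `h`. -/
theorem coeff_eqn_of_commute {c : Finset V → Finset V → ℂ} {G : Finset V → ℂ} {h : ℂ}
    (hc : Commute (∑ a, ∑ b, c a b • xzProduct a b)
      (∑ T, G T • xzProduct ∅ T + h • ∑ s, xzProduct {s} ∅)) (a b : Finset V) :
    ∑ T with Odd (T ∩ a).card, G T * c a (b ∆ T) = h * ∑ s ∈ b, c (a ∆ {s}) b := by
  have hperm : ∀ T : Finset V, Function.Involutive fun b : Finset V => b ∆ T := fun T b =>
    symmDiff_symmDiff_cancel_right T b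
  -- A `Z`-product and a string commute or anticommute according to the parity of `T ∩ a`;
  -- reindexing by the involution `b ↦ b ∆ T` collects the commutator by target string.
  have hZ : ∀ T : Finset V, (∑ a, ∑ b, c a b • xzProduct a b) * xzProduct ∅ T -
      xzProduct ∅ T * (∑ a, ∑ b, c a b • xzProduct a b) =
      ∑ a, ∑ b, ((if Odd (T ∩ a).card then 2 else 0) * c a (b ∆ T)) • xzProduct a b := by
    intro T
    rw [Finset.sum_mul, Finset.mul_sum, ← Finset.sum_sub_distrib]
    refine Finset.sum_congr rfl fun a _ => ?_
    rw [Finset.sum_mul, Finset.mul_sum, ← Finset.sum_sub_distrib]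
    refine Fintype.sum_equiv (hperm T).toPerm _ _ fun b => ?_
    rw [Function.Involutive.coe_toPerm, symmDiff_symmDiff_cancel_right, smul_mul_assoc,
      mul_smul_comm, xzProduct_mul, xzProduct_mul, ← Finset.bot_eq_empty, symmDiff_bot,
      bot_symmDiff, symmDiff_comm T b, Finset.bot_eq_empty, Finset.inter_empty, Finset.card_empty,
      pow_zero, one_smul, ← smul_sub]
    split_ifs with hT
    · rw [hT.neg_one_pow, neg_one_smul, sub_neg_eq_add, ← two_smul ℂ, smul_smul, mul_comm]
    · rw [(Nat.not_odd_iff_even.1 hT).neg_one_pow, one_smul, sub_self, smul_zero, zero_mul,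
        zero_smul]
  -- Here the sign arises from the product in the other order, since `X` precedes `Z` in a string.
  -- Hence `-2`, which puts the field term on the other side of the equation.
  have hX : ∀ s : V, (∑ a, ∑ b, c a b • xzProduct a b) * xzProduct {s} ∅ -
      xzProduct {s} ∅ * (∑ a, ∑ b, c a b • xzProduct a b) =
      ∑ a, ∑ b, ((if s ∈ b then -2 else 0) * c (a ∆ {s}) b) • xzProduct a b := by
    intro s
    rw [Finset.sum_mul, Finset.mul_sum, ← Finset.sum_sub_distrib]
    refine Fintype.sum_equiv (hperm {s}).toPerm _ _ fun a => ?_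
    rw [Finset.sum_mul, Finset.mul_sum, ← Finset.sum_sub_distrib]
    refine Finset.sum_congr rfl fun b _ => ?_
    rw [Function.Involutive.coe_toPerm, symmDiff_symmDiff_cancel_right, smul_mul_assoc,
      mul_smul_comm, xzProduct_mul, xzProduct_mul, ← Finset.bot_eq_empty, symmDiff_bot,
      bot_symmDiff, symmDiff_comm {s} a, Finset.bot_eq_empty, Finset.empty_inter,
      Finset.card_empty, pow_zero, one_smul, ← smul_sub]
    split_ifs with hs
    · rw [Finset.inter_singleton_of_mem hs, Finset.card_singleton, pow_one, neg_one_smul,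
        ← neg_add', ← two_smul ℂ, ← neg_smul, smul_smul, mul_comm]
    · rw [Finset.inter_singleton_of_notMem hs, Finset.card_empty, pow_zero, one_smul, sub_self,
        smul_zero, zero_mul, zero_smul]
  have hsum : ∑ a, ∑ b, (∑ T, G T * ((if Odd (T ∩ a).card then 2 else 0) * c a (b ∆ T)) +
      h * ∑ s, ((if s ∈ b then -2 else 0) * c (a ∆ {s}) b)) • xzProduct a b = 0 := by
    generalize ∑ a, ∑ b, c a b • xzProduct a b = Q at hc hZ hX
    have hQ := sub_eq_zero.2 hc.eq
    rw [mul_add, add_mul, Finset.mul_sum, Finset.sum_mul, add_sub_add_comm,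
      ← Finset.sum_sub_distrib, mul_smul_comm, smul_mul_assoc, ← smul_sub, Finset.mul_sum,
      Finset.sum_mul, ← Finset.sum_sub_distrib] at hQ
    simp only [mul_smul_comm, smul_mul_assoc, ← smul_sub, hZ, hX] at hQ
    rw [← hQ]
    simp only [add_smul, Finset.sum_add_distrib, Finset.smul_sum, Finset.mul_sum, Finset.sum_smul,
      smul_smul]
    congr 1 <;>
    · symm
      rw [Finset.sum_comm]
      exact Finset.sum_congr rfl fun _ _ => Finset.sum_comm
  have := eq_zero_of_sum_xzProduct_eq_zero hsum a b
  simp only [ite_mul, zero_mul, mul_ite, mul_zero, ← Finset.sum_filter, Finset.filter_univ_mem]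
    at this
  refine mul_left_cancel₀ (two_ne_zero (α := ℂ)) ?_
  rw [← sub_eq_zero, ← this, Finset.mul_sum, Finset.mul_sum, Finset.mul_sum, Finset.mul_sum,
    sub_eq_add_neg, ← Finset.sum_neg_distrib]
  congr 1 <;> refine Finset.sum_congr rfl fun _ _ => by ring

/-! ### Pauli strings and the lattice Hamiltonian in this basis. -/

variable {d L : ℕ}

/-- Whether a Pauli operator contains a factor `X`. -/
def Pauli.hasX : Pauli → Bool
  | .X | .Y => true
  | _ => false

/-- Whether a Pauli operator contains a factor `Z`. -/
def Pauli.hasZ : Pauli → Bool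
  | .Z | .Y => true
  | _ => false

/-- The phase of a Pauli operator relative to the product of its factors `X` and `Z`. -/
noncomputable def Pauli.phase : Pauli → ℂ
  | .Y => Complex.I
  | _ => 1

theorem Pauli.phase_ne_zero (σ : Pauli) : σ.phase ≠ 0 := by
  cases σ <;> simp [phase]

theorem Pauli.toMatrix_eq (σ : Pauli) : σ.toMatrix = σ.phase • xzSite σ.hasX σ.hasZ := by
  cases σ <;> ext i j <;> fin_cases i <;> fin_cases j <;>
    simp [toMatrix, phase, xzSite, hasX, hasZ]

/-- The Pauli operator with given factors. -/
def Pauli.ofXZ : Bool → Bool → Pauli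
  | true, true => .Y
  | true, false => .X
  | false, true => .Z
  | false, false => .I

@[simp] theorem Pauli.hasX_ofXZ (α β : Bool) : (Pauli.ofXZ α β).hasX = α := by
  cases α <;> cases β <;> rfl

@[simp] theorem Pauli.hasZ_ofXZ (α β : Bool) : (Pauli.ofXZ α β).hasZ = β := by
  cases α <;> cases β <;> rfl

@[simp] theorem Pauli.ofXZ_hasX_hasZ (σ : Pauli) : Pauli.ofXZ σ.hasX σ.hasZ = σ := by
  cases σ <;> rfl

theorem Pauli.ofXZ_ne_I_iff {α β : Bool} : Pauli.ofXZ α β ≠ .I ↔ α = true ∨ β = true := by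
  cases α <;> cases β <;> simp [ofXZ]

/-- Pauli strings correspond to pairs of the sets of sites carrying factors `X` and `Z`. -/
def stringEquiv (V : Type*) [Fintype V] [DecidableEq V] :
    (V → Pauli) ≃ Finset V × Finset V where
  toFun A := (Finset.univ.filter fun p => (A p).hasX, Finset.univ.filter fun p => (A p).hasZ)
  invFun ab p := Pauli.ofXZ (p ∈ ab.1) (p ∈ ab.2)
  left_inv A := by ext1 p; simp
  right_inv ab := by ext p <;> simp

theorem unitVec_add_ne_zero (hL : 3 ≤ L) (μ ν : Fin d) :
    (unitVec μ + unitVec ν : Site d L) ≠ 0 := by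
  intro h
  have h1 := congr_fun h μ
  have hcast : ∀ n : ℕ, 0 < n → n < 3 → ((n : ℕ) : ZMod L) ≠ 0 := by
    intro n h0 h3 h
    rw [ZMod.natCast_eq_zero_iff] at h
    have := Nat.le_of_dvd h0 h
    omega
  by_cases hμ : μ = ν
  · subst hμ
    refine hcast 2 (by omega) (by omega) ?_
    simpa [unitVec, one_add_one_eq_two] using h1
  · refine hcast 1 (by omega) (by omega) ?_
    simpa [unitVec, Pi.single_apply, hμ] using h1

theorem unitVec_injective (hL : 3 ≤ L) : Function.Injective (unitVec : Fin d → Site d L) := by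
  intro μ ν h
  by_contra hμ
  have : Fact (1 < L) := ⟨by omega⟩
  have h1 := congr_fun h μ
  simp [unitVec, hμ] at h1

theorem unitVec_ne_zero (hL : 3 ≤ L) (μ : Fin d) : (unitVec μ : Site d L) ≠ 0 := by
  have : Fact (1 < L) := ⟨by omega⟩
  simp [unitVec]

/-- For side length at least `3` a bond determines its starting site and its direction, so distinct
couplings never add up on the same `Z`-product. -/
theorem bond_injective (hL : 3 ≤ L) {p r : Site d L} {μ ν : Fin d}
    (h : ({p, p + unitVec μ} : Finset (Site d L)) = {r, r + unitVec ν}) : p = r ∧ μ = ν := by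
  have h1 : p ∈ ({r, r + unitVec ν} : Finset (Site d L)) := h ▸ Finset.mem_insert_self _ _
  have h2 : p + unitVec μ ∈ ({r, r + unitVec ν} : Finset (Site d L)) := by simp [← h]
  rw [Finset.mem_insert, Finset.mem_singleton] at h1 h2
  have hμ := unitVec_ne_zero (d := d) hL μ
  rcases h1 with rfl | rfl
  · refine ⟨rfl, unitVec_injective hL ?_⟩
    simpa [hμ] using h2
  · rcases h2 with h2 | h2
    · rw [add_assoc, add_eq_left] at h2
      exact absurd h2 (unitVec_add_ne_zero hL ν μ)
    · exact absurd h2 (by simpa using hμ)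

variable [NeZero L]

theorem pauliProduct_eq (A : Site d L → Pauli) :
    pauliProduct A = (∏ p, (A p).phase) •
      xzProduct (stringEquiv _ A).1 (stringEquiv _ A).2 := by
  rw [xzProduct, ← siteTensor_smul]
  simp [pauliProduct, siteTensor, Pauli.toMatrix_eq, stringEquiv]

theorem siteOp_Z (r : Site d L) : siteOp .Z r = xzProduct ∅ {r} := by
  rw [siteOp, pauliProduct_eq, Finset.prod_eq_one, one_smul]
  · congr 1 <;> ext p <;> by_cases h : p = r <;>
      simp [stringEquiv, Function.update_apply, h, Pauli.hasX, Pauli.hasZ]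
  · intro p _
    by_cases h : p = r <;> simp [h, Pauli.phase]

theorem siteOp_X (r : Site d L) : siteOp .X r = xzProduct {r} ∅ := by
  rw [siteOp, pauliProduct_eq, Finset.prod_eq_one, one_smul]
  · congr 1 <;> ext p <;> by_cases h : p = r <;>
      simp [stringEquiv, Function.update_apply, h, Pauli.hasX, Pauli.hasZ]
  · intro p _
    by_cases h : p = r <;> simp [h, Pauli.phase]

/-- The coefficient of `∏_{p ∈ T} Z_p` in the Hamiltonian. -/
noncomputable def coupling (J : Fin d → ℝ) (hz : ℝ) (T : Finset (Site d L)) : ℂ :=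
  ∑ r : Site d L, ((∑ μ, if T = {r, r + unitVec μ} then (J μ : ℂ) else 0) +
    if T = {r} then (hz : ℂ) else 0)

theorem hamiltonian_eq (hL : 3 ≤ L) (J : Fin d → ℝ) (hx hz : ℝ) :
    (hamiltonian J hx hz : Op d L) =
      ∑ T, coupling J hz T • xzProduct ∅ T + (hx : ℂ) • ∑ s, xzProduct {s} ∅ := by
  have hZZ : ∀ (r : Site d L) (μ : Fin d), siteOp .Z r * siteOp .Z (r + unitVec μ) =
      xzProduct ∅ {r, r + unitVec μ} := by
    intro r μ
    have hne : r + unitVec μ ≠ r := by simpa using unitVec_ne_zero hL μ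
    have hset : ({r} : Finset (Site d L)) ∆ {r + unitVec μ} = {r, r + unitVec μ} := by
      ext p
      simp only [Finset.mem_symmDiff, Finset.mem_singleton, Finset.mem_insert]
      grind
    rw [siteOp_Z, siteOp_Z, xzProduct_mul, hset]
    simp
  have hsum : ∑ T : Finset (Site d L), coupling J hz T • xzProduct ∅ T =
      ∑ r : Site d L, ((∑ μ : Fin d, (J μ : ℂ) • xzProduct ∅ {r, r + unitVec μ}) +
        (hz : ℂ) • xzProduct ∅ {r}) := by
    simp only [coupling, Finset.sum_smul, add_smul, ite_smul, zero_smul]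
    rw [Finset.sum_comm]
    refine Finset.sum_congr rfl fun r _ => ?_
    rw [Finset.sum_add_distrib, Finset.sum_comm]
    simp
  rw [hsum, Finset.smul_sum, ← Finset.sum_add_distrib, hamiltonian]
  refine Finset.sum_congr rfl fun r _ => ?_
  simp only [hZZ]
  rw [siteOp_X, siteOp_Z]
  abel

theorem coupling_bond (hL : 3 ≤ L) (J : Fin d → ℝ) (hz : ℝ) (p : Site d L) (μ : Fin d) :
    coupling J hz {p, p + unitVec μ} = J μ := by
  have h1 : ∀ r : Site d L, ({p, p + unitVec μ} : Finset (Site d L)) ≠ {r} := by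
    intro r h
    have := congr_arg Finset.card h
    rw [Finset.card_pair (by simpa using unitVec_ne_zero (L := L) hL μ)] at this
    simp at this
  rw [coupling, Finset.sum_eq_single p, Finset.sum_eq_single μ]
  · simp [h1]
  · intro ν _ hν
    exact if_neg fun h => hν (bond_injective hL h).2.symm
  · simp
  · intro r _ hr
    simp only [h1, if_false, add_zero]
    exact Finset.sum_eq_zero fun ν _ => if_neg fun h => hr (bond_injective hL h).1.symm
  · simp

theorem exists_of_coupling_ne_zero {J : Fin d → ℝ} {hz : ℝ} {T : Finset (Site d L)}
    (h : coupling J hz T ≠ 0) :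
    (∃ r μ, T = {r, r + unitVec μ}) ∨ ∃ r, T = {r} := by
  by_contra! hcon
  refine h (Finset.sum_eq_zero fun r _ => ?_)
  simp [hcon.1, hcon.2]

/-- Every site lies in exactly one layer, so the sum over layers is a fibrewise sum over sites. -/
theorem stackHamiltonian_eq (J : Fin d → ℝ) (hx hz : ℝ) :
    (stackHamiltonian J hx hz : Op d L) =
      hamiltonian (fun μ => if μ.val < 2 then J μ else 0) hx hz := by
  have hF : ∀ r : Site d L,
      ∑ μ : Fin d with μ.val < 2, (J μ : ℂ) • (siteOp .Z r * siteOp .Z (r + unitVec μ)) =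
        ∑ μ : Fin d, ((if μ.val < 2 then J μ else 0 : ℝ) : ℂ) •
          (siteOp .Z r * siteOp .Z (r + unitVec μ)) := by
    intro r
    rw [Finset.sum_filter]
    refine Finset.sum_congr rfl fun μ _ => ?_
    split_ifs <;> simp
  rw [stackHamiltonian, hamiltonian]
  simp only [layerHamiltonian, hF]
  rw [← Finset.sum_fiberwise Finset.univ
    (fun (r : Site d L) (μ : {μ : Fin d // 2 ≤ (μ : ℕ)}) => r μ.1)]
  refine Finset.sum_congr rfl fun s _ => Finset.sum_congr ?_ fun _ _ => rfl
  ext r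
  simp [funext_iff]

/-! ### Side lengths and conclusion. -/

/-- A Pauli string of width `n` touches both end planes of some slab of width `n` containing it. -/
theorem exists_slab_of_sideLength {A : Set (Site d L)} {μ : Fin d} {n : ℕ} (hn : 0 < n)
    (h : sideLength A μ = n) :
    ∃ m : ZMod L, (∃ p ∈ A, p μ = m) ∧ ∃ p ∈ A, p μ = m + (n - 1 : ℕ) := by
  obtain ⟨⟨r, hr⟩, hmin⟩ := isLeast_sideLength A
  refine ⟨r μ, ?_, ?_⟩
  · by_contra! hcon
    -- If the first plane were missed, moving the corner one step along `μ` would give a smaller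
    -- cuboid.
    have := hmin (a := Function.update (sideLength A) μ (n - 1)) ⟨r + unitVec μ, fun p hp ν => ?_⟩ μ
    · simp at this
      omega
    · obtain ⟨i, hi, hpi⟩ := hr hp ν
      by_cases hν : ν = μ
      · subst hν
        have hi0 : i ≠ 0 := by
          rintro rfl
          exact hcon p hp (by simpa using hpi)
        refine ⟨i - 1, by simp; omega, ?_⟩
        rw [hpi, Nat.cast_sub (by omega)]
        simp [unitVec]
      · exact ⟨i, by simpa [hν] using hi, by simp [hpi, unitVec, hν]⟩
  · by_contra! hcon
    have := hmin (a := Function.update (sideLength A) μ (n - 1)) ⟨r, fun p hp ν => ?_⟩ μ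
    · simp at this
      omega
    · obtain ⟨i, hi, hpi⟩ := hr hp ν
      by_cases hν : ν = μ
      · subst hν
        have hi0 : i ≠ n - 1 := by
          rintro rfl
          exact hcon p hp hpi
        exact ⟨i, by simp; omega, hpi⟩
      · exact ⟨i, by simpa [hν] using hi, hpi⟩

/-- The model has no conserved quantity whose width in a direction `μ` lies between `3` and half the
side length of the lattice. -/
theorem not_isLocalConserved (J : Fin d → ℝ) (hx hz : ℝ) {μ ν : Fin d} (hμν : μ ≠ ν)
    (hμ : J μ ≠ 0) (hν : J ν ≠ 0) (hhx : hx ≠ 0) (k : Fin d → ℕ) (hk : 3 ≤ k μ)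
    (hkL : 2 * k μ ≤ L) (Q : Op d L) : ¬ IsLocalConserved (hamiltonian J hx hz) k Q := by
  rintro ⟨hcomm, c, hQ, hgreat⟩
  have hL : 3 ≤ L := by omega
  have hsum : Q = ∑ a, ∑ b, (c ((stringEquiv _).symm (a, b)) *
      ∏ p, ((stringEquiv (Site d L)).symm (a, b) p).phase) • xzProduct a b := by
    rw [hQ, ← Fintype.sum_prod_type' (f := fun a b => (c ((stringEquiv _).symm (a, b)) *
      ∏ p, ((stringEquiv (Site d L)).symm (a, b) p).phase) • xzProduct a b)]
    refine Fintype.sum_equiv (stringEquiv _) _ _ fun A => ?_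
    rw [pauliProduct_eq, smul_smul, Prod.mk.eta, Equiv.symm_apply_apply]
  rw [hsum, hamiltonian_eq hL] at hcomm
  have hsupp : ∀ (a b : Finset (Site d L)) p,
      p ∈ support ((stringEquiv _).symm (a, b)) ↔ p ∈ a ∪ b := by
    intro a b p
    simp [support, stringEquiv, Pauli.ofXZ_ne_I_iff]
  -- Slicing is along `μ`, decoration along `ν`. The phases are absorbed into `c` because `Y` is `I`
  -- times `X Z`; they do not vanish, so the coefficients have the same zeros.
  let S : CoeffSystem (Site d L) L (k μ) :=
    { x := Pi.evalAddMonoidHom (fun _ => ZMod L) μ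
      e := unitVec μ
      f := unitVec ν
      G := coupling J hz
      J := J μ
      K := J ν
      h := hx
      c := fun a b => c ((stringEquiv _).symm (a, b)) *
        ∏ p, ((stringEquiv (Site d L)).symm (a, b) p).phase
      three_le := hk
      two_mul_le := hkL
      x_e := by simp [unitVec]
      x_f := by simp [unitVec, hμν]
      f_ne := unitVec_ne_zero hL ν
      J_ne := by exact_mod_cast hμ
      K_ne := by exact_mod_cast hν
      h_ne := by exact_mod_cast hhx
      G_e := fun p => coupling_bond hL J hz p μ
      G_f := fun p => coupling_bond hL J hz p ν
      G_local := by
        intro T hT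
        rcases exists_of_coupling_ne_zero hT with ⟨r, μ', rfl⟩ | ⟨r, rfl⟩
        · by_cases hμ' : μ' = μ
          · exact .inr ⟨r, by rw [hμ']⟩
          · left
            simp [unitVec, Ne.symm hμ']
        · left
          simp
      slab := by
        intro a b hc
        have hc' := left_ne_zero_of_mul hc
        have hle := (hgreat μ).2 ⟨_, hc', rfl⟩
        obtain ⟨r, hr⟩ := (isLeast_sideLength (support ((stringEquiv _).symm (a, b)))).1
        refine ⟨(r μ).cast, fun y hy => ?_⟩
        obtain ⟨n, hn, hyn⟩ := hr ((hsupp a b y).2 hy) μ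
        exact ⟨(r μ).cast + n, by omega, by omega, by simp [hyn]⟩
      eqn := coeff_eqn_of_commute hcomm }
  obtain ⟨A, hA, hside⟩ := (hgreat μ).1
  obtain ⟨m, ⟨p, hp, hpm⟩, q, hq, hqm⟩ := exists_slab_of_sideLength (by omega) hside
  obtain ⟨⟨a, b⟩, rfl⟩ := (stringEquiv (Site d L)).symm.surjective A
  rw [hsupp] at hp hq
  have hzero : S.c a b = 0 := CoeffSystem.c_eq_zero_of_width (m := m.cast) hq
    (by
      change q μ = _
      rw [hqm, Nat.cast_sub (by omega)]
      push_cast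
      ring) hp
    (by
      change p μ = _
      rw [hpm, ZMod.intCast_zmod_cast])
  exact mul_ne_zero hA (Finset.prod_ne_zero_iff.2 fun p _ => Pauli.phase_ne_zero _) hzero

end QuantumIsing

theorem theorem3 (d L : ℕ) [NeZero L] (hd : 2 ≤ d) (J : Fin d → ℝ) (hx hz : ℝ)
    (hJ1 : J ⟨0, by omega⟩ ≠ 0) (hJ2 : J ⟨1, by omega⟩ ≠ 0) (hhx : hx ≠ 0)
    (k : Fin d → ℕ) (hk3 : 3 ≤ k ⟨0, by omega⟩) (hkL : 2 * k ⟨0, by omega⟩ ≤ L) :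
    (¬ ∃ Q : QuantumIsing.Op d L,
      QuantumIsing.IsLocalConserved (QuantumIsing.hamiltonian J hx hz) k Q) ∧
    (¬ ∃ Q : QuantumIsing.Op d L,
      QuantumIsing.IsLocalConserved (QuantumIsing.stackHamiltonian J hx hz) k Q) := by
  have hne : (⟨0, by omega⟩ : Fin d) ≠ ⟨1, by omega⟩ := by simp
  constructor
  · rintro ⟨Q, hQ⟩
    exact QuantumIsing.not_isLocalConserved J hx hz hne hJ1 hJ2 hhx k hk3 hkL Q hQ
  · rintro ⟨Q, hQ⟩
    rw [QuantumIsing.stackHamiltonian_eq] at hQ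
    exact QuantumIsing.not_isLocalConserved _ hx hz hne (by simpa using hJ1) (by simpa using hJ2)
      hhx k hk3 hkL Q hQ
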